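/- Let $r,n\ge 1$ be integers. Let $G_{r,n}=\mathbb Z_r\wr S_n$ be the group of all permutations $\pi$ of $\{1,\dots,n\}\times\{0,\dots,r-1\}$ such that $\pi(a,0)=(c,j)$ implies $\pi(a,i)=(c,i+j)$ for all $i$, where $i+j$ is computed modulo $r$. Write $\pi$ as the word $\pi=(\pi_1,\dots,\pi_n)=(\sigma_1^{z_1},\dots,\sigma_n^{z_n})$ of colored integers, where $\pi(i,0)=(\sigma_i,z_i)$ and $0\le z_i\le r-1$; a letter without an exponent has color $0$. Put $$\mathrm{inv}(|\pi|)=\#\{(i,j):i<j,\ \sigma_i>\sigma_j\},\qquad \mathrm{col}(\pi)=z_1+\cdots+z_n,\qquad \mathrm{fmaj}(\pi)=r\sum_{1\le i\le n-1,\ \pi_i>\pi_{i+1}} i+\mathrm{col}(\pi),$$ where colored integers are ordered by $1^{r-1}<\cdots<n^{r-1}<\cdots<1^1<\cdots<n^1<1<\cdots<n$. Fix a primitive $r$th root of unity $\zeta\in\mathbb C$, and for $0\le h\le r-1$ let $\chi_{-1,h}(\pi)=(-1)^{\mathrm{inv}(|\pi|)}\zeta^{h\,\mathrm{col}(\pi)}$.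 For a colored word $W$, let $G_{r,n}(W)$ be the set of $\pi\in G_{r,n}$ such that the word $(\pi_1,\dots,\pi_n)$ contains $W$ as a (not necessarily contiguous) subsequence. Let $q$ be an indeterminate and write $[m]_y=1+y+\cdots+y^{m-1}$ (so $[0]_y=0$). **Theorem.** Let $1\le k\le n-1$, $k+1\le b\le n$, $b\equiv n \pmod 2$ and $0\le h\le r-1$, and let $$U=(b-k,b-k+1,\dots,b-1),\qquad V=(b-k+1,b-k+2,\dots,b).$$ Put $P_a=\prod_{j=a}^{n}[jr]_{(-1)^{j-1}\zeta^hq}$, which is $1$ if $a>n$. Then the following identities hold in $\mathbb C[q]$. 1. If $k$ is odd, then $$\sum_{\pi\in G_{r,n}(U)}\chi_{-1,h}(\pi)q^{\mathrm{fmaj}(\pi)}+\sum_{\pi\in G_{r,n}(V)}\chi_{-1,h}(\pi)q^{\mathrm{fmaj}(\pi)}=\begin{cases}2\,[k+1]_{-q^r}\,P_{k+2}& n\text{ even},\\ 2\,[k+1]_{-q^r}[k+2]_{q^r}[r]_{\zeta^hq}\,P_{k+3}& n\text{ odd}.\end{cases}$$ 2. If $k$ is even, then $$\sum_{\pi\in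 G_{r,n}(U)\setminus G_{r,n}(V)}\chi_{-1,h}(\pi)q^{\mathrm{fmaj}(\pi)}+\sum_{\pi\in G_{r,n}(V)\setminus G_{r,n}(U)}\chi_{-1,h}(\pi)q^{\mathrm{fmaj}(\pi)}=\begin{cases}2\,[k+1]_{-q^r}\big([r]_{\zeta^hq}-1\big)\,P_{k+2}& n\text{ odd},\\ 2\,f(r;q)\,[k+1]_{q^r}[k+2]_{-q^r}\,P_{k+3}& n\text{ even},\end{cases}$$ where $f(r;q)=-(\zeta^hq)\,[r-1]_{(-1)^r\zeta^hq}\,[r]_{(-1)^{r-1}\zeta^hq}$. -/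

import Mathlib

namespace ColoredPerm

/-- The group of `r`-colored permutations of `n` letters (the wreath product of the cyclic group
of order `r` with the symmetric group): all permutations `π` of `[n] × [0, r-1]` such that
`π (a, 0) = (b, j)` implies `π (a, i) = (b, i + j)`, with `i + j` computed modulo `r`.
The letter `a ∈ [n]` is encoded by `a - 1 : Fin n`. -/
def G (r n : ℕ) [NeZero r] : Subgroup (Equiv.Perm (Fin n × Fin r)) where
  carrier := {π | ∀ a i, π (a, i) = ((π (a, 0)).1, i + (π (a, 0)).2)}
  one_mem' := by intro a i; simp
  mul_mem' := by
    intro π τ hπ hτ a i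
    have h1 := hπ (τ (a, 0)).1 (i + (τ (a, 0)).2)
    have h2 := hπ (τ (a, 0)).1 (τ (a, 0)).2
    simp only [Equiv.Perm.mul_apply]
    rw [hτ a i, h1, show τ (a, 0) = ((τ (a, 0)).1, (τ (a, 0)).2) from rfl, h2]
    simp [add_assoc]
  inv_mem' := by
    intro π hπ a i
    rw [Equiv.Perm.inv_eq_iff_eq]
    have h1 := hπ (π⁻¹ (a, 0)).1 (i + (π⁻¹ (a, 0)).2)
    have h2 := hπ (π⁻¹ (a, 0)).1 (π⁻¹ (a, 0)).2
    have hc : π (π⁻¹ (a, 0)) = (a, 0) := π.apply_symm_apply (a, 0)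
    rw [show ((π⁻¹ (a, 0)).1, (π⁻¹ (a, 0)).2) = π⁻¹ (a, 0) from rfl, hc] at h2
    have h3 := congrArg Prod.fst h2
    have h4 := congrArg Prod.snd h2
    simp only at h3 h4
    rw [h1, ← h3, add_assoc, ← h4, add_zero]

instance (r n : ℕ) [NeZero r] : DecidablePred (· ∈ G r n) := fun π =>
  inferInstanceAs (Decidable (∀ a i, π (a, i) = ((π (a, 0)).1, i + (π (a, 0)).2)))

/-- A colored integer `m ^ z`, as the pair of its absolute value `m` and its color `z`. -/
abbrev ColInt : Type := ℕ × ℕ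

/-- The order `1^(r-1) < ⋯ < n^(r-1) < ⋯ < 1^1 < ⋯ < n^1 < 1^0 < ⋯ < n^0` on colored integers. -/
def ColLT (x y : ColInt) : Prop := y.2 < x.2 ∨ (x.2 = y.2 ∧ x.1 < y.1)

instance (x y : ColInt) : Decidable (ColLT x y) :=
  inferInstanceAs (Decidable (y.2 < x.2 ∨ (x.2 = y.2 ∧ x.1 < y.1)))

/-- Inversion number of the absolute values of a colored word. -/
def inv (w : List ColInt) : ℕ :=
  (Finset.univ.filter fun p : Fin w.length × Fin w.length =>
    p.1 < p.2 ∧ (w.get p.2).1 < (w.get p.1).1).card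

/-- Color weight of a colored word. -/
def col (w : List ColInt) : ℕ := (w.map Prod.snd).sum

/-- Major index of a colored word: the sum of the positions `i` (counted from `1`) with
`w_i > w_{i+1}` in the order `ColLT`. -/
def majF (w : List ColInt) : ℕ :=
  ∑ i ∈ Finset.range w.length,
    if ∃ h : i + 1 < w.length, ColLT w[i + 1] w[i] then i + 1 else 0

/-- Flag major index. -/
def fmaj (r : ℕ) (w : List ColInt) : ℕ := r * majF w + col w

/-- Window notation `(π_1, …, π_n)`, where `π_i = π (i, 0)` as a colored integer. -/
def window {r n : ℕ} [NeZero r] (π : G r n) : List ColInt :=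
  List.ofFn fun i : Fin n =>
    (((π : Equiv.Perm (Fin n × Fin r)) (i, 0)).1.val + 1,
      ((π : Equiv.Perm (Fin n × Fin r)) (i, 0)).2.val)

/-- The value `ε ^ inv |π| * ζ ^ (h * col π)` of the one-dimensional character `χ_{ε,h}`. -/
noncomputable def chi {r n : ℕ} [NeZero r] (ζ ε : ℂ) (h : ℕ) (π : G r n) : ℂ :=
  ε ^ inv (window π) * ζ ^ (h * col (window π))

/-- The elements of `G r n` whose window contains the colored word `W` as a subsequence. -/
def containing (r n : ℕ) [NeZero r] (W : List ColInt) : Finset (G r n) :=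
  Finset.univ.filter fun π => W.Sublist (window π)

/-- The word `(a, a + 1, …, a + k - 1)` of `k` consecutive letters of color `0`. -/
def run (a k : ℕ) : List ColInt := (List.range' a k).map fun m => (m, 0)

/-- The signed Mahonian polynomial `∑_{π ∈ S} χ_{ε,h}(π) q ^ fmaj π` over a set `S`. -/
noncomputable def signedMahonian {r n : ℕ} [NeZero r] (ζ ε : ℂ) (h : ℕ)
    (S : Finset (G r n)) : Polynomial ℂ :=
  ∑ π ∈ S, Polynomial.C (chi ζ ε h π) * Polynomial.X ^ fmaj r (window π)

/-- `[m]_x = 1 + x + ⋯ + x ^ (m - 1)`. -/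
noncomputable def qnum (m : ℕ) (x : Polynomial ℂ) : Polynomial ℂ :=
  ∑ i ∈ Finset.range m, x ^ i

/-- The product `[a r]_{(-1)^(a-1) x} [(a+1) r]_{(-1)^a x} ⋯ [n r]_{(-1)^(n-1) x}`, for `a ≥ 1`
(it is `1` if `a > n`). -/
noncomputable def tailProd (r a n : ℕ) (x : Polynomial ℂ) : Polynomial ℂ :=
  ∏ j ∈ Finset.Icc a n, qnum (j * r) ((-1) ^ (j - 1) * x)

/-- The factor `f(r; q)`, as a function of `x = ζ ^ h q`. -/
noncomputable def fFactor (r : ℕ) (x : Polynomial ℂ) : Polynomial ℂ :=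
  -x * qnum (r - 1) ((-1) ^ r * x) * qnum r ((-1) ^ (r - 1) * x)

end ColoredPerm

/-! A word containing `W` arises from `W` by inserting the missing absolute values, with all
possible colors, in any chosen order; so a sum over `containing r n W` is an iterated insertion sum
(`sum_containing`). With `x = ζ ^ h q` one has `x ^ r = q ^ r`, hence the summand is `weight (x ^ r)
x`, a function of `x` alone.

Inserting two consecutive absolute values `a`, `a + 1` is cheap. Exchanging them flips the sign and
keeps the descents, unless they are adjacent with the same color. Only monochromatic blocks survive,
and their sum multiplies the weight by a factor depending only on the length
(`sum_ins_ins_eq_pairFactor`); this factor is two consecutive factors of `tailProd`.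

Since `b ≡ n` mod 2, the letters above `b` pair off. Let `a = b - k - 1` be the number of letters
below `U`. If `a` is even, the unpaired letters are `b` for `U` and `b - k` for `V`. If `a` is odd,
they are `a` and `b` for `U`, and none for `V`. These one or two letters are inserted into the bare
run first. Each is extremal in absolute value, so its sign alternates with its place. In the color
order it is least, or greatest if it is `b` with color 0, so only descent words matter
(`iterIns_run_min`, `iterIns_run_max`, `iterIns_run_max_min`).

For `k` even, the overlap of `U` and `V` forces a word containing both to contain their union, a run
of length `k + 1`; inclusion-exclusion then reduces to the same insertion sums. -/

namespace ColoredPerm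

/-! ### Insertion sums and the cancellation for a pair of letters -/

section Insertion

variable {R : Type*} [CommRing R]

/-- The sum of `F` over all words obtained by inserting the letter `e` into a word. -/
def ins (e : ColInt) : List ColInt → (List ColInt → R) → R
  | [], F => F [e]
  | y :: t, F => F (e :: y :: t) + ins e t fun u => F (y :: u)

/-- The alternating sum of `F` over all words obtained by inserting the letter `e` into a word,
with sign given by the number of letters before `e`. -/
def alt (e : ColInt) : List ColInt → (List ColInt → R) → R
  | [], F => F [e]
  | y :: t, F => F (e :: y :: t) - alt e t fun u => F (y :: u)

/-- The sum of `F` over all words obtained by inserting the two-letter block `e f`. -/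
def insBlock (e f : ColInt) : List ColInt → (List ColInt → R) → R
  | [], F => F [e, f]
  | y :: t, F => F (e :: f :: y :: t) + insBlock e f t fun u => F (y :: u)

/-- The sum of `F` over all words obtained by inserting `e` and, further to the right but not
next to it, `f`. -/
def insApart (e f : ColInt) : List ColInt → (List ColInt → R) → R
  | [], _ => 0
  | y :: t, F => ins f t (fun u => F (e :: y :: u)) + insApart e f t fun u => F (y :: u)

theorem ins_congr {e : ColInt} {w : List ColInt} {F F' : List ColInt → R}
    (h : ∀ A B, A ++ B = w → F (A ++ e :: B) = F' (A ++ e :: B)) : ins e w F = ins e w F' := by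
  induction w generalizing F F' with
  | nil => exact h [] [] rfl
  | cons y t ih =>
    simp only [ins]
    rw [show F (e :: y :: t) = F' (e :: y :: t) from h [] (y :: t) rfl,
      ih (F := fun u => F (y :: u)) (F' := fun u => F' (y :: u))
        fun A B hAB => h (y :: A) B (by simp [hAB])]

theorem ins_add (e : ColInt) (w : List ColInt) (F F' : List ColInt → R) :
    ins e w (fun u => F u + F' u) = ins e w F + ins e w F' := by
  induction w generalizing F F' with
  | nil => rfl
  | cons y t ih => simp only [ins, ih]; ring

theorem ins_mul_left (e : ColInt) (w : List ColInt) (c : R) (F : List ColInt → R) :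
    ins e w (fun u => c * F u) = c * ins e w F := by
  induction w generalizing F with
  | nil => rfl
  | cons y t ih => simp only [ins, ih]; ring

theorem ins_sum {ι : Type*} (s : Finset ι) (e : ColInt) (w : List ColInt)
    (F : ι → List ColInt → R) :
    ins e w (fun u => ∑ i ∈ s, F i u) = ∑ i ∈ s, ins e w (F i) := by
  induction w generalizing F with
  | nil => rfl
  | cons y t ih => simp only [ins, ih, Finset.sum_add_distrib]

theorem insBlock_mul_left (e f : ColInt) (w : List ColInt) (c : R) (F : List ColInt → R) :
    insBlock e f w (fun u => c * F u) = c * insBlock e f w F := by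
  induction w generalizing F with
  | nil => rfl
  | cons y t ih => simp only [insBlock, ih]; ring

theorem ins_eq_mul_alt {e : ColInt} {w : List ColInt} {F F' : List ColInt → R} {c : R}
    (h : ∀ A B, A ++ B = w → F (A ++ e :: B) = c * (-1) ^ A.length * F' (A ++ e :: B)) :
    ins e w F = c * alt e w F' := by
  induction w generalizing F F' c with
  | nil => simpa [ins, alt] using h [] [] rfl
  | cons y t ih =>
    have h0 := h [] (y :: t) rfl
    have h1 := ih (F := fun u => F (y :: u)) (F' := fun u => F' (y :: u)) (c := -c)
      fun A B hAB => by
        have := h (y :: A) B (by simp [hAB])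
        simpa [pow_succ] using this
    simp only [ins, alt, h1]
    simp only [List.nil_append, List.length_nil, pow_zero, mul_one] at h0
    rw [h0]; ring

/-- Transfer between two block insertions. -/
theorem insBlock_eq_mul {e f e' f' : ColInt} {w : List ColInt} {F F' : List ColInt → R} {c : R}
    (h : ∀ A B, A ++ B = w → F (A ++ e :: f :: B) = c * F' (A ++ e' :: f' :: B)) :
    insBlock e f w F = c * insBlock e' f' w F' := by
  induction w generalizing F F' with
  | nil => exact h [] [] rfl
  | cons y t ih =>
    have h0 : F (e :: f :: y :: t) = _ := h [] (y :: t) rfl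
    simp only [insBlock]
    rw [h0, ih (F := fun u => F (y :: u)) (F' := fun u => F' (y :: u))
      fun A B hAB => h (y :: A) B (by simp [hAB])]
    simp only [List.nil_append]
    ring

theorem ins_eq_neg {e e' : ColInt} {w : List ColInt} {F F' : List ColInt → R}
    (h : ∀ A B, A ++ B = w → F (A ++ e :: B) = -F' (A ++ e' :: B)) :
    ins e w F = -ins e' w F' := by
  induction w generalizing F F' with
  | nil => exact h [] [] rfl
  | cons y t ih =>
    have h0 : F (e :: y :: t) = _ := h [] (y :: t) rfl
    simp only [ins]
    rw [h0, ih (F := fun u => F (y :: u)) (F' := fun u => F' (y :: u))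
      fun A B hAB => h (y :: A) B (by simp [hAB])]
    simp only [List.nil_append]
    ring

theorem insApart_eq_neg {e f e' f' : ColInt} {w : List ColInt} {F : List ColInt → R}
    (h : ∀ A B C, A ++ B ++ C = w → B ≠ [] →
      F (A ++ e :: (B ++ f :: C)) = -F (A ++ e' :: (B ++ f' :: C))) :
    insApart e f w F = -insApart e' f' w F := by
  induction w generalizing F with
  | nil => simp [insApart]
  | cons y t ih =>
    simp only [insApart]
    rw [ih (F := fun u => F (y :: u)) fun A B C hABC hB => h (y :: A) B C (by simp [← hABC]) hB,
      ins_eq_neg (F' := fun u => F (e' :: y :: u)) fun A B hAB =>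
        h [] (y :: A) B (by simp [hAB]) (by simp)]
    ring

theorem ins_ins (e f : ColInt) (w : List ColInt) (F : List ColInt → R) :
    ins e w (fun u => ins f u F) = insBlock e f w F + insBlock f e w F + insApart e f w F +
      insApart f e w F := by
  induction w generalizing F with
  | nil => simp [ins, insBlock, insApart]; ring
  | cons y t ih => simp only [ins, insBlock, insApart, ins_add, ih]; ring

theorem ins_comm (e f : ColInt) (w : List ColInt) (F : List ColInt → R) :
    ins e w (fun u => ins f u F) = ins f w (fun u => ins e u F) := by
  rw [ins_ins, ins_ins]; ring

/-- If exchanging the absolute values of two letters changes the sign of `F`, unless the letters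
are adjacent and have the same color, then only the monochromatic blocks contribute to the sum
over the insertions of both letters. -/
theorem sum_ins_ins (ρ a b : ℕ) (w : List ColInt) (F : List ColInt → R)
    (h : ∀ A B C y z, A ++ B ++ C = w → B ≠ [] ∨ y ≠ z →
      F (A ++ (a, y) :: (B ++ (b, z) :: C)) = -F (A ++ (b, y) :: (B ++ (a, z) :: C))) :
    ∑ y ∈ Finset.range ρ, ∑ z ∈ Finset.range ρ, ins (a, y) w (fun u => ins (b, z) u F) =
      ∑ z ∈ Finset.range ρ, (insBlock (a, z) (b, z) w F + insBlock (b, z) (a, z) w F) := by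
  simp only [ins_ins, Finset.sum_add_distrib]
  -- The exchange keeps each color at its place, so the two letters trade colors. This is why the
  -- sum over both colors is needed.
  have h1 : ∑ y ∈ Finset.range ρ, ∑ z ∈ Finset.range ρ, insApart (b, z) (a, y) w F =
      -∑ y ∈ Finset.range ρ, ∑ z ∈ Finset.range ρ, insApart (a, y) (b, z) w F := by
    rw [Finset.sum_comm, ← Finset.sum_neg_distrib]
    refine Finset.sum_congr rfl fun y _ => ?_
    rw [← Finset.sum_neg_distrib]
    refine Finset.sum_congr rfl fun z _ => ?_
    rw [insApart_eq_neg (e' := (b, y)) (f' := (a, z)) fun A B C hw hB => h A B C y z hw (.inl hB),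
      neg_neg]
  -- Adjacent letters cancel in the same way off the diagonal `y = z`.
  have h2 : ∑ y ∈ Finset.range ρ, ∑ z ∈ Finset.range ρ, insBlock (b, z) (a, y) w F =
      ∑ z ∈ Finset.range ρ, (insBlock (b, z) (a, z) w F + insBlock (a, z) (b, z) w F) -
      ∑ y ∈ Finset.range ρ, ∑ z ∈ Finset.range ρ, insBlock (a, y) (b, z) w F := by
    rw [Finset.sum_comm, ← Finset.sum_sub_distrib]
    refine Finset.sum_congr rfl fun y hy => ?_
    rw [eq_sub_iff_add_eq, ← Finset.sum_add_distrib, Finset.sum_eq_single_of_mem y hy]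
    intro z _ hz
    rw [insBlock_eq_mul (c := -1) (F' := F) (e := (b, y)) (f := (a, z)) (e' := (a, y))
      (f' := (b, z)) fun A B hw => ?_]
    · ring
    · have := h A [] B y z (by simpa using hw) (.inr hz.symm)
      simp only [List.nil_append] at this
      rw [this]; ring
  rw [h1, h2]
  simp only [Finset.sum_add_distrib]
  ring

end Insertion

/-! ### Descents, inversions and colors under insertion -/

theorem colLT_def (x y : ColInt) : ColLT x y ↔ y.2 < x.2 ∨ (x.2 = y.2 ∧ x.1 < y.1) := Iff.rfl

/-- The descent word: its `i`-th entry records whether `w_i > w_{i+1}`. -/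
def desWord : List ColInt → List Bool
  | x :: y :: t => decide (ColLT y x) :: desWord (y :: t)
  | _ => []

/-- The sum of the positions of `true`, where the first position is `s`. -/
def posSum : ℕ → List Bool → ℕ
  | _, [] => 0
  | s, d :: L => (if d then s else 0) + posSum (s + 1) L

/-- The inversion number of the absolute values, defined recursively. -/
def invRec : List ColInt → ℕ
  | [] => 0
  | x :: t => t.countP (fun y => y.1 < x.1) + invRec t

theorem posSum_add (s k : ℕ) (L : List Bool) :
    posSum (s + k) L = posSum s L + k * L.count true := by
  induction L generalizing s with
  | nil => simp [posSum]
  | cons d L ih =>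
    have := ih (s + 1)
    rw [show s + 1 + k = s + k + 1 by ring] at this
    cases d <;> simp [posSum, this] ; ring

theorem desWord_append {e f : ColInt} {A T T' : List ColInt}
    (hA : ∀ y ∈ A, ColLT e y ↔ ColLT f y) (hT : desWord (e :: T) = desWord (f :: T')) :
    desWord (A ++ e :: T) = desWord (A ++ f :: T') := by
  induction A with
  | nil => exact hT
  | cons x A ih =>
    have ih := ih fun y hy => hA y (by simp [hy])
    cases A with
    | nil => simp [desWord, hA x (by simp), hT]
    | cons y A => simpa [desWord] using ih

theorem desWord_cons {e f : ColInt} {T : List ColInt} (hT : ∀ y ∈ T, ColLT y e ↔ ColLT y f) :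
    desWord (e :: T) = desWord (f :: T) := by
  cases T with
  | nil => rfl
  | cons y T => simp [desWord, hT y (by simp)]

/-- No other letter separates `a` from `a + 1` in the color order, so only a comparison of these two
with each other could change. It occurs only if they are adjacent, and different colors decide it
independently of the absolute values. -/
theorem desWord_swap {a y z : ℕ} {A B C : List ColInt}
    (ha : ∀ l ∈ A ++ B ++ C, l.1 ≠ a ∧ l.1 ≠ a + 1) (hB : B ≠ [] ∨ y ≠ z) :
    desWord (A ++ (a, y) :: (B ++ (a + 1, z) :: C)) =
      desWord (A ++ (a + 1, y) :: (B ++ (a, z) :: C)) := by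
  have h1 : ∀ (c : ℕ), ∀ l ∈ A ++ B ++ C, ColLT (a, c) l ↔ ColLT (a + 1, c) l := by
    intro c l hl
    have := ha l hl
    simp only [colLT_def]; omega
  have h2 : ∀ (c : ℕ), ∀ l ∈ A ++ B ++ C, ColLT l (a, c) ↔ ColLT l (a + 1, c) := by
    intro c l hl
    have := ha l hl
    simp only [colLT_def]; omega
  have hC : desWord ((a + 1, z) :: C) = desWord ((a, z) :: C) :=
    desWord_cons fun l hl => (h2 z l (by simp [hl])).symm
  refine desWord_append (fun l hl => h1 y l (by simp [hl])) ?_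
  cases B with
  | nil =>
    have : y ≠ z := by simpa using hB
    simp only [List.nil_append, desWord, hC, List.cons.injEq, and_true, decide_eq_decide]
    simp only [colLT_def]; omega
  | cons b B =>
    have h3 : desWord (b :: B ++ (a + 1, z) :: C) = desWord (b :: B ++ (a, z) :: C) :=
      desWord_append (fun l hl => (h1 z l (by
        simp only [List.mem_append]; exact .inl (.inr hl))).symm) hC
    simp only [List.cons_append] at h3
    simp only [List.cons_append, desWord, h3, List.cons.injEq, and_true, decide_eq_decide]
    exact h2 y b (by simp)

theorem invRec_append_cons (e : ColInt) (A T : List ColInt) :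
    invRec (A ++ e :: T) = invRec (A ++ T) + A.countP (fun y => e.1 < y.1) +
      T.countP (fun y => y.1 < e.1) := by
  induction A with
  | nil => simp [invRec]; ring
  | cons x A ih =>
    simp only [List.cons_append, invRec, List.countP_append, List.countP_cons, ih,
      decide_eq_true_eq]
    ring

theorem countP_gt_succ {a : ℕ} {A : List ColInt} (ha : ∀ l ∈ A, l.1 ≠ a ∧ l.1 ≠ a + 1) :
    A.countP (fun y => a + 1 < y.1) = A.countP (fun y => a < y.1) := by
  refine List.countP_congr fun l hl => ?_
  have := ha l hl
  simp only [decide_eq_true_eq]; omega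

theorem countP_lt_succ {a : ℕ} {A : List ColInt} (ha : ∀ l ∈ A, l.1 ≠ a ∧ l.1 ≠ a + 1) :
    A.countP (fun y => y.1 < a + 1) = A.countP (fun y => y.1 < a) := by
  refine List.countP_congr fun l hl => ?_
  have := ha l hl
  simp only [decide_eq_true_eq]; omega

theorem invRec_swap {a y z : ℕ} {A B C : List ColInt}
    (ha : ∀ l ∈ A ++ B ++ C, l.1 ≠ a ∧ l.1 ≠ a + 1) :
    invRec (A ++ (a + 1, y) :: (B ++ (a, z) :: C)) =
      invRec (A ++ (a, y) :: (B ++ (a + 1, z) :: C)) + 1 := by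
  have hA : ∀ l ∈ A, l.1 ≠ a ∧ l.1 ≠ a + 1 := fun l hl => ha l (by simp [hl])
  have hB : ∀ l ∈ B, l.1 ≠ a ∧ l.1 ≠ a + 1 := fun l hl => ha l (by simp [hl])
  have hC : ∀ l ∈ C, l.1 ≠ a ∧ l.1 ≠ a + 1 := fun l hl => ha l (by simp [hl])
  rw [invRec_append_cons, invRec_append_cons]
  simp only [← List.append_assoc]
  rw [invRec_append_cons, invRec_append_cons]
  simp only [List.countP_append, List.countP_cons, countP_gt_succ hA, countP_gt_succ hB,
    countP_lt_succ hB, countP_lt_succ hC, decide_eq_true_eq]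
  simp
  ring

/-- Every other letter forms an inversion with both letters of the block or with neither, so the
block does not affect the sign. -/
theorem invRec_block {a y z : ℕ} {A B : List ColInt}
    (ha : ∀ l ∈ A ++ B, l.1 ≠ a ∧ l.1 ≠ a + 1) :
    invRec (A ++ (a, y) :: (a + 1, z) :: B) = invRec (A ++ B) +
      2 * (A.countP (fun y => a < y.1) + B.countP (fun y => y.1 < a)) := by
  have hA : ∀ l ∈ A, l.1 ≠ a ∧ l.1 ≠ a + 1 := fun l hl => ha l (by simp [hl])
  have hB : ∀ l ∈ B, l.1 ≠ a ∧ l.1 ≠ a + 1 := fun l hl => ha l (by simp [hl])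
  rw [invRec_append_cons, invRec_append_cons]
  simp only [List.countP_cons, countP_gt_succ hA, countP_lt_succ hB]
  simp
  ring

theorem col_append_cons (A B : List ColInt) (e : ColInt) : col (A ++ e :: B) = col (A ++ B) + e.2 := by
  simp [col]; ring

/-! ### The weight and the block insertion sum -/

section Weight

variable {R : Type*} [CommRing R]

/-- The weight of a colored word: its sign times `X ^ maj * x ^ col`. -/
def weight (X x : R) (w : List ColInt) : R :=
  (-1) ^ invRec w * X ^ posSum 1 (desWord w) * x ^ col w

theorem weight_swap (X x : R) {a y z : ℕ} {A B C : List ColInt}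
    (ha : ∀ l ∈ A ++ B ++ C, l.1 ≠ a ∧ l.1 ≠ a + 1) (hB : B ≠ [] ∨ y ≠ z) :
    weight X x (A ++ (a, y) :: (B ++ (a + 1, z) :: C)) =
      -weight X x (A ++ (a + 1, y) :: (B ++ (a, z) :: C)) := by
  simp only [weight, desWord_swap ha hB, invRec_swap ha]
  rw [show col (A ++ (a + 1, y) :: (B ++ (a, z) :: C)) =
    col (A ++ (a, y) :: (B ++ (a + 1, z) :: C)) by simp [col]]
  ring

/-- Sum over the insertions of two equal-colored consecutive letters as a block behind the letter
`p`, which has position `s`. -/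
theorem insBlock_pow_posSum (X : R) (a z : ℕ) (w : List ColInt) (p : ColInt) (s : ℕ)
    (ha : ∀ l ∈ p :: w, l.1 ≠ a ∧ l.1 ≠ a + 1) :
    (1 - X ^ 2) *
      (insBlock (a, z) (a + 1, z) w (fun u => X ^ posSum s (desWord (p :: u))) -
        insBlock (a + 1, z) (a, z) w (fun u => X ^ posSum s (desWord (p :: u)))) =
    X ^ posSum s (desWord (p :: w)) *
      (X ^ (2 * ((desWord (p :: w)).count true + if ColLT p (a, z) then 1 else 0)) *
        (X ^ s + X ^ (s + 1) - X ^ (2 * s + 1) - 1) + 1 - X ^ (s + w.length + 1) -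
          X ^ (s + w.length + 2) + X ^ (2 * s + 2 * w.length + 3)) := by
  have h1 : ∀ l ∈ p :: w, (ColLT l (a + 1, z) ↔ ColLT l (a, z)) := by
    intro l hl
    have := ha l hl
    simp only [colLT_def]; omega
  have h2 : ∀ l ∈ p :: w, (ColLT (a, z) l ↔ ¬ColLT l (a, z)) := by
    intro l hl
    have := ha l hl
    simp only [colLT_def]; omega
  have h3 : ∀ l ∈ p :: w, (ColLT (a + 1, z) l ↔ ¬ColLT l (a, z)) := by
    intro l hl
    have := ha l hl
    simp only [colLT_def]; omega
  have h4 : ColLT (a, z) (a + 1, z) := by simp [colLT_def]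
  have h5 : ¬ColLT (a + 1, z) (a, z) := by simp [colLT_def]
  induction w generalizing p s with
  | nil =>
    have hp2 := h2 p (by simp)
    have hp3 := h3 p (by simp)
    by_cases hp : ColLT p (a, z) <;> simp [insBlock, desWord, posSum, hp2, hp3, hp, h4, h5] <;> ring
  | cons y t ih =>
    have ih := ih y (s + 1) (fun l hl => ha l (by simp [hl])) (fun l hl => h1 l (by simp [hl]))
      (fun l hl => h2 l (by simp [hl])) (fun l hl => h3 l (by simp [hl]))
    have e1 : ∀ u, X ^ posSum s (desWord (p :: y :: u)) =
        X ^ (if ColLT y p then s else 0) * X ^ posSum (s + 1) (desWord (y :: u)) := by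
      intro u
      rw [← pow_add]; simp [desWord, posSum]
    simp only [insBlock]
    simp only [e1, insBlock_mul_left]
    rw [show ∀ a b c d e : R, (1 - X ^ 2) * (a + c * b - (d + c * e)) =
      (1 - X ^ 2) * (a - d) + c * ((1 - X ^ 2) * (b - e)) by intros; ring, ih]
    have hp2 := h2 p (by simp)
    have hp3 := h3 p (by simp)
    have hy1 := h1 y (by simp)
    -- If `(a, z)` lies between `p` and `y`, their comparison is forced by transitivity; this
    -- discards the impossible cases of the split below.
    have hpy : (ColLT y (a, z) → ¬ColLT p (a, z) → ColLT y p) ∧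
        (ColLT p (a, z) → ¬ColLT y (a, z) → ¬ColLT y p) := by
      have := ha p (by simp)
      have := ha y (by simp)
      simp only [colLT_def]
      constructor <;> intros <;> omega
    have e2 : posSum (s + 1 + 1 + 1) (desWord (y :: t)) = posSum (s + 1) (desWord (y :: t)) + 2 *
      (desWord (y :: t)).count true := posSum_add (s + 1) 2 _
    generalize hM : posSum (s + 1) (desWord (y :: t)) = M at *
    generalize hK : (desWord (y :: t)).count true = K at *
    by_cases hp : ColLT p (a, z) <;> by_cases hy : ColLT y (a, z) <;> by_cases hd : ColLT y p <;>
      simp only [hp, hy, hd, not_true, not_false_eq_true, forall_true_left, and_true,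
        and_false, false_and, true_and] at hpy <;>
      simp [desWord, posSum, hp2, hp3, hp, hy, hy1, hd, h4, h5, e2, hK] <;>
      ring

end Weight

/-! ### Inserting a pair, and inserting an extremal letter -/

section Pair

variable {R : Type*} [CommRing R]

theorem posSum_zero_desWord_cons (p : ColInt) (w : List ColInt) :
    posSum 0 (desWord (p :: w)) = posSum 1 (desWord w) := by
  cases w <;> simp [desWord, posSum]

theorem sum_ins_ins_weight (X x : R) (ρ a : ℕ) (w : List ColInt)
    (ha : ∀ l ∈ w, l.1 ≠ a ∧ l.1 ≠ a + 1) :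
    (1 - X ^ 2) * ∑ y ∈ Finset.range ρ, ∑ z ∈ Finset.range ρ,
      ins (a, y) w (fun u => ins (a + 1, z) u (weight X x)) =
    weight X x w * ((1 - X ^ (w.length + 1)) * (1 - X ^ (w.length + 2))) *
      ∑ z ∈ Finset.range ρ, (x ^ 2) ^ z := by
  rw [sum_ins_ins ρ a (a + 1) w _ fun A B C y z hw h => weight_swap X x (by rwa [hw]) h,
    Finset.mul_sum, Finset.mul_sum]
  refine Finset.sum_congr rfl fun z _ => ?_
  -- A dummy letter in position 0: a descent there counts 0, and at `s = 0` the bracket `X ^ s + X ^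
  -- (s + 1) - X ^ (2 * s + 1) - 1` vanishes, so the dependence on the descents of `w` disappears.
  have h := insBlock_pow_posSum X a z w (a + 2, 0) 0 (by
    intro l hl
    rcases List.mem_cons.1 hl with rfl | hl
    · simp
    · exact ha l hl)
  simp only [posSum_zero_desWord_cons] at h
  have hsq : ∀ k : ℕ, ((-1 : R)) ^ (2 * k) = 1 := fun k => by simp
  have b1 : insBlock (a, z) (a + 1, z) w (weight X x) = ((-1) ^ invRec w * x ^ (col w + 2 * z)) *
      insBlock (a, z) (a + 1, z) w (fun u => X ^ posSum 1 (desWord u)) := by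
    refine insBlock_eq_mul fun A B hw => ?_
    rw [weight, invRec_block (by rwa [hw]), hw, pow_add _ (invRec w), hsq,
      col_append_cons, col_append_cons, hw]
    ring
  have b2 : insBlock (a + 1, z) (a, z) w (weight X x) = (-((-1) ^ invRec w * x ^ (col w + 2 * z))) *
      insBlock (a + 1, z) (a, z) w (fun u => X ^ posSum 1 (desWord u)) := by
    refine insBlock_eq_mul fun A B hw => ?_
    have := invRec_swap (a := a) (y := z) (z := z) (A := A) (B := []) (C := B)
      (by simpa using fun l hl => ha l (by rw [← hw]; simpa using hl))
    rw [List.nil_append, List.nil_append] at this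
    rw [weight, this, invRec_block (by rwa [hw]), hw, pow_succ, pow_add _ (invRec w), hsq,
      col_append_cons, col_append_cons, hw]
    ring
  rw [b1, b2, weight]
  linear_combination ((-1) ^ invRec w * x ^ (col w + 2 * z)) * h

/-- The alternating sum of `Φ` over the descent words obtained by inserting a least letter into a
word with descent word `L`, not in front. -/
def leastAfter : List Bool → (List Bool → R) → R
  | [], Φ => Φ [true]
  | d :: L, Φ => Φ (true :: false :: L) - leastAfter L fun u => Φ (d :: u)

/-- A least letter makes a descent just before itself and none after, whatever its neighbours are,
so the new descent word is determined by the old one and the place. -/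
theorem alt_cons_desWord_of_least (Φ : List Bool → R) {e y : ColInt} {t : List ColInt}
    (h : ∀ l ∈ y :: t, ColLT e l ∧ ¬ColLT l e) :
    alt e (y :: t) (fun u => Φ (desWord u)) =
      Φ (false :: desWord (y :: t)) - leastAfter (desWord (y :: t)) Φ := by
  have key : alt e t (fun u => Φ (desWord (y :: u))) = leastAfter (desWord (y :: t)) Φ := by
    induction t generalizing y Φ with
    | nil => simp [alt, desWord, leastAfter, h y (by simp)]
    | cons z t ih =>
      have := ih (y := z) (fun u => Φ (decide (ColLT z y) :: u)) fun l hl => h l (by simp [hl])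
      simp only [alt, desWord, leastAfter] at this ⊢
      rw [this]
      simp [h y, h z]
  simp only [alt]
  rw [key]
  simp [desWord, h y]

/-- In an increasing word, a greatest letter with `i` letters before it creates the same single
descent as a least letter with `i + 1` before it. The extra term is the greatest letter placed at
the end. -/
theorem alt_cons_desWord_of_greatest (Φ : List Bool → R) {e y : ColInt} {t : List ColInt}
    (h : ∀ l ∈ y :: t, ColLT l e ∧ ¬ColLT e l)
    (ht : desWord (y :: t) = List.replicate t.length false) :
    alt e (y :: t) (fun u => Φ (desWord u)) =
      leastAfter (List.replicate t.length false) Φ +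
        (-1) ^ (t.length + 1) * Φ (List.replicate (t.length + 1) false) := by
  induction t generalizing y Φ with
  | nil => simp [alt, desWord, leastAfter, h y]; ring
  | cons z t ih =>
    simp only [desWord, List.length_cons, List.replicate_succ, List.cons.injEq] at ht
    have := ih (y := z) (fun u => Φ (false :: u)) (fun l hl => h l (by simp [hl])) ht.2
    rw [alt]
    have e1 : alt e (z :: t) (fun u => Φ (desWord (y :: u))) =
        alt e (z :: t) (fun u => Φ (false :: desWord u)) := by
      simp only [alt, desWord, ht.1]
      simp [h y, h z]
    rw [e1, this]
    simp only [desWord, List.length_cons, List.replicate_succ, leastAfter, ht]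
    simp [h y]
    ring

theorem posSum_replicate (s j : ℕ) : posSum s (List.replicate j false) = 0 := by
  induction j generalizing s with
  | zero => rfl
  | succ j ih => simp [List.replicate_succ, posSum, ih]

theorem leastAfter_replicate_pow_posSum (X : R) (s j : ℕ) :
    leastAfter (List.replicate j false) (fun L => X ^ posSum s L) =
      X ^ s * ∑ i ∈ Finset.range (j + 1), (-X) ^ i := by
  induction j generalizing s with
  | zero => simp [leastAfter, posSum]
  | succ j ih =>
    have h := ih (s + 1)
    rw [Finset.sum_range_succ']
    simp only [List.replicate_succ, leastAfter]
    simp only [posSum, posSum_replicate, Bool.false_eq_true, if_false, if_true, zero_add, h,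
      pow_succ (-X), ← Finset.sum_mul]
    ring

end Pair

/-! ### Subsequences of a fixed word under insertion -/

section Lists

variable {R : Type*} [CommRing R]

theorem ins_sublist_of_not_mem (e : ColInt) {w v : List ColInt} (he : e ∉ v) (C : List ColInt) :
    ins e w (fun u => if (C ++ u).Sublist v then (1 : R) else 0) = 0 := by
  have : ins e w (fun u => if (C ++ u).Sublist v then (1 : R) else 0) =
      ins e w (fun _ => 0 * 0) := by
    refine ins_congr fun A B _ => ?_
    rw [if_neg, mul_zero]
    intro h
    exact he (h.subset (by simp))
  rw [this, ins_mul_left, zero_mul]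

/-- In a word without repetitions the place of `e` relative to a subsequence `w` is unique, so
exactly one insertion of `e` into `w` is again a subsequence. -/
theorem ins_sublist {e : ColInt} {w v : List ColInt} (hv : v.Nodup) (he : e ∈ v) (hw : e ∉ w) :
    ins e w (fun u => if u.Sublist v then (1 : R) else 0) = if w.Sublist v then 1 else 0 := by
  induction v generalizing w with
  | nil => simp at he
  | cons u v ih =>
    obtain ⟨huv, hv'⟩ := List.nodup_cons.1 hv
    cases w with
    | nil => simp [ins, List.mem_cons.1 he]
    | cons y t =>
      have hy : e ≠ y := fun h => hw (by simp [h])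
      have ht : e ∉ t := fun h => hw (by simp [h])
      by_cases hu : u = e
      · subst hu
        have h0 := ins_sublist_of_not_mem (R := R) u (w := t) huv [y]
        simp only [List.singleton_append] at h0
        simp only [ins, List.sublist_cons_iff (a := u), List.cons.injEq,
          hy.symm, false_and, exists_false, or_false]
        simp [h0]
      · have hev : e ∈ v := by simpa [Ne.symm hu] using he
        by_cases hyu : y = u
        · subst hyu
          have : ¬(e :: y :: t).Sublist (y :: v) := by
            intro h
            rw [List.sublist_cons_iff] at h
            rcases h with h | ⟨r, h, -⟩
            · exact huv (h.subset (by simp))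
            · simp [hy] at h
          simp only [ins, List.cons_sublist_cons, this, if_false, zero_add]
          exact ih hv' hev ht
        · have h1 : ∀ r, (y :: r).Sublist (u :: v) ↔ (y :: r).Sublist v := by
            intro r; rw [List.sublist_cons_iff]; simp [hyu]
          have h2 : ∀ r, (e :: r).Sublist (u :: v) ↔ (e :: r).Sublist v := by
            intro r; rw [List.sublist_cons_iff]; simp [Ne.symm hu]
          have := ih hv' hev hw
          simp only [ins] at this ⊢
          simp only [h1, h2]
          exact this

end Lists

/-! ### Recursive forms of the statistics -/

section Statistics

theorem inv_eq_invRec (w : List ColInt) : inv w = invRec w := by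
  induction w with
  | nil => rfl
  | cons x t ih =>
    have h1 : t.countP (fun y => y.1 < x.1) =
        ∑ j : Fin t.length, if (t.get j).1 < x.1 then 1 else 0 := by
      clear ih
      induction t with
      | nil => simp
      | cons y t ih =>
        rw [List.countP_cons, ih]
        simp only [List.length_cons, Fin.sum_univ_succ, List.get_cons_zero, decide_eq_true_eq]
        rw [add_comm]
        rfl
    have h2 : ∀ w : List ColInt, inv w = ∑ i : Fin w.length, ∑ j : Fin w.length,
        if i < j ∧ (w.get j).1 < (w.get i).1 then 1 else 0 := by
      intro w
      rw [inv, Finset.card_filter, Fintype.sum_prod_type]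
    rw [invRec, ← ih, h1, h2, h2]
    simp only [List.length_cons, Fin.sum_univ_succ, List.get_cons_zero]
    simp

theorem majF_eq_posSum (w : List ColInt) : majF w = posSum 1 (desWord w) := by
  have key : ∀ s, (∑ i ∈ Finset.range w.length,
      if ∃ h : i + 1 < w.length, ColLT w[i + 1] w[i] then i + s else 0) =
      posSum s (desWord w) := by
    induction w with
    | nil => intro s; simp [desWord, posSum]
    | cons x t ih =>
      intro s
      refine (Finset.sum_range_succ' _ t.length).trans ?_
      cases t with
      | nil => simp [desWord, posSum]
      | cons y t =>
        have := ih (s + 1)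
        simp only [desWord, posSum, decide_eq_true_eq, ← this]
        rw [add_comm]
        congr 1
        · simp
        · refine Finset.sum_congr rfl fun i _ => ?_
          simp only [List.length_cons, List.getElem_cons_succ, Nat.add_lt_add_iff_right]
          congr 1
          ring
  exact key 1

end Statistics

/-! ### Windows as words with absolute values `1, …, n` -/

section Window

variable {r n : ℕ} [NeZero r]

theorem window_length (π : G r n) : (window π).length = n := by simp [window]

theorem G_apply (π : G r n) (a : Fin n) (i : Fin r) : (π : Equiv.Perm (Fin n × Fin r)) (a, i) =
    (((π : Equiv.Perm (Fin n × Fin r)) (a, 0)).1,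
      i + ((π : Equiv.Perm (Fin n × Fin r)) (a, 0)).2) := π.2 a i

theorem G_fst_injective (π : G r n) :
    Function.Injective fun i : Fin n => ((π : Equiv.Perm (Fin n × Fin r)) (i, 0)).1 := by
  intro i j hij
  have hi := G_apply π i (-((π : Equiv.Perm (Fin n × Fin r)) (i, 0)).2)
  have hj := G_apply π j (-((π : Equiv.Perm (Fin n × Fin r)) (j, 0)).2)
  simp only at hij
  rw [neg_add_cancel] at hi hj
  rw [hij, ← hj] at hi
  exact congrArg Prod.fst ((π : Equiv.Perm (Fin n × Fin r)).injective hi)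

theorem window_map_fst_perm (π : G r n) : ((window π).map Prod.fst).Perm (List.range' 1 n) := by
  have h : ((window π).map Prod.fst).Nodup := by
    rw [window, List.map_ofFn, List.nodup_ofFn]
    intro i j hij
    refine G_fst_injective π ?_
    simpa [Fin.ext_iff] using hij
  refine (List.subperm_of_subset h ?_).perm_of_length_le (by simp [window])
  intro a ha
  simp only [window, List.map_ofFn, List.mem_ofFn, Function.comp_apply] at ha
  obtain ⟨i, rfl⟩ := ha
  rw [List.mem_range'_1]
  have := ((π : Equiv.Perm (Fin n × Fin r)) (i, 0)).1.2
  omega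

theorem snd_lt_of_mem_window {π : G r n} {l : ColInt} (hl : l ∈ window π) : l.2 < r := by
  simp only [window, List.mem_ofFn] at hl
  obtain ⟨i, rfl⟩ := hl
  exact ((π : Equiv.Perm (Fin n × Fin r)) (i, 0)).2.2

theorem window_injective : Function.Injective (window : G r n → List ColInt) := by
  intro π τ h
  have h := List.ofFn_injective h
  refine Subtype.ext (Equiv.ext fun ⟨a, i⟩ => ?_)
  have ha := congrFun h a
  simp only [Prod.mk.injEq, Nat.add_right_cancel_iff, Fin.val_inj] at ha
  rw [G_apply π, G_apply τ, ha.1, ha.2]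

theorem exists_window_eq {w : List ColInt} (hw : (w.map Prod.fst).Perm (List.range' 1 n))
    (hr : ∀ l ∈ w, l.2 < r) : ∃ π : G r n, window π = w := by
  have hlen : w.length = n := by simpa using hw.length_eq
  subst hlen
  have hnd : (w.map Prod.fst).Nodup := hw.nodup_iff.2 List.nodup_range'
  have hmem : ∀ i : Fin w.length, 1 ≤ (w.get i).1 ∧ (w.get i).1 - 1 < w.length := by
    intro i
    have : (w.get i).1 ∈ List.range' 1 w.length :=
      hw.subset (List.mem_map_of_mem (List.get_mem w i))
    rw [List.mem_range'_1] at this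
    omega
  let f : Fin w.length × Fin r → Fin w.length × Fin r := fun p =>
    (⟨(w.get p.1).1 - 1, (hmem p.1).2⟩, p.2 + ⟨(w.get p.1).2, hr _ (List.get_mem w p.1)⟩)
  have hf : Function.Injective f := by
    rintro ⟨i, c⟩ ⟨j, d⟩ h
    simp only [f, Prod.mk.injEq, Fin.mk.injEq] at h
    have hij : i = j := by
      have h1 : (w.get i).1 = (w.get j).1 := by
        have := hmem i
        have := hmem j
        omega
      have := (List.nodup_iff_injective_get.1 hnd) (a₁ := i.cast (by simp))
        (a₂ := j.cast (by simp)) (by simpa using h1)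
      simpa [Fin.ext_iff] using this
    subst hij
    simpa using h.2
  have h0 : ∀ a, f (a, 0) = (⟨(w.get a).1 - 1, (hmem a).2⟩,
      ⟨(w.get a).2, hr _ (List.get_mem w a)⟩) := fun a => by simp only [f, zero_add]
  refine ⟨⟨Equiv.ofBijective f hf.bijective_of_finite, fun a i => ?_⟩, ?_⟩
  · simp only [Equiv.ofBijective_apply, h0]
    rfl
  · rw [window]
    simp only [Equiv.ofBijective_apply, h0]
    refine List.ext_get (by simp) fun i h1 h2 => ?_
    have := hmem ⟨i, h2⟩
    simp only [List.get_ofFn]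
    refine Prod.ext ?_ rfl
    simp only [Fin.cast_mk]
    omega

end Window

/-! ### Sums over `containing` as iterated insertions -/

section Iterate

variable {R : Type*} [CommRing R]

/-- The sum of `F` over all words obtained by inserting, one after the other, letters with given
absolute values and arbitrary colors less than `r`. -/
def iterIns (r : ℕ) : List ℕ → List ColInt → (List ColInt → R) → R
  | [], w, F => F w
  | a :: as, w, F => ∑ z ∈ Finset.range r, ins (a, z) w fun u => iterIns r as u F

theorem eq_of_mem_of_fst_eq {v : List ColInt} (hv : (v.map Prod.fst).Nodup) {l l' : ColInt}
    (hl : l ∈ v) (hl' : l' ∈ v) (h : l.1 = l'.1) : l = l' :=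
  List.inj_on_of_nodup_map hv hl hl' h

theorem sum_ins_sublist {r a : ℕ} {w v : List ColInt} (hv : (v.map Prod.fst).Nodup)
    (hr : ∀ l ∈ v, l.2 < r) (ha : a ∈ v.map Prod.fst) (haw : a ∉ w.map Prod.fst) :
    ∑ z ∈ Finset.range r, ins (a, z) w (fun u => if u.Sublist v then (1 : R) else 0) =
      if w.Sublist v then 1 else 0 := by
  obtain ⟨⟨a, z⟩, hz, rfl⟩ := List.mem_map.1 ha
  rw [Finset.sum_eq_single_of_mem z (Finset.mem_range.2 (hr _ hz))]
  · exact ins_sublist hv.of_map hz fun h => haw (List.mem_map_of_mem h)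
  · intro y _ hy
    refine ins_sublist_of_not_mem (a, y) (fun h => hy ?_) []
    exact congrArg Prod.snd (eq_of_mem_of_fst_eq hv h hz rfl)

/-- Each word containing `W` has a unique letter of absolute value `a`, so it contains exactly one
extension of `W` by such a letter. The order of `as` is free, which later allows the pairs to be put
last. -/
theorem sum_containing {r n : ℕ} [NeZero r] (F : List ColInt → R) (as : List ℕ) (W : List ColInt)
    (hW : (as ++ W.map Prod.fst).Perm (List.range' 1 n)) (hr : ∀ l ∈ W, l.2 < r) :
    ∑ π ∈ containing r n W, F (window π) = iterIns r as W F := by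
  have hsum : ∀ W : List ColInt, ∑ π ∈ containing r n W, F (window π) =
      ∑ π : G r n, F (window π) * if W.Sublist (window π) then 1 else 0 := by
    intro W
    rw [containing, Finset.sum_filter]
    exact Finset.sum_congr rfl fun π _ => by simp
  induction as generalizing W with
  | nil =>
    obtain ⟨π, rfl⟩ := exists_window_eq hW hr
    rw [iterIns, Finset.sum_eq_single_of_mem π (by simp [containing])]
    intro τ hτ hne
    have hτ : (window π).Sublist (window τ) := by simpa [containing] using hτ
    exact (hne (window_injective (hτ.eq_of_length (by simp [window_length])).symm)).elim
  | cons a as ih =>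
    have hnd : (a :: as ++ W.map Prod.fst).Nodup := hW.nodup_iff.2 List.nodup_range'
    have haW : a ∉ W.map Prod.fst := by
      rw [List.cons_append, List.nodup_cons, List.mem_append] at hnd
      exact fun h => hnd.1 (.inr h)
    have ha : a ∈ List.range' 1 n := hW.subset (by simp)
    have h1 : iterIns r (a :: as) W F = ∑ z ∈ Finset.range r, ins (a, z) W fun u =>
        ∑ π : G r n, F (window π) * if u.Sublist (window π) then 1 else 0 := by
      refine Finset.sum_congr rfl fun z hz => ins_congr fun A B hAB => ?_
      rw [← hsum, ih]
      · refine List.Perm.trans ?_ hW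
        rw [← hAB]
        simp only [List.map_append, List.map_cons, List.cons_append, ← List.append_assoc]
        exact List.perm_middle
      · intro l hl
        have hl : l ∈ A ++ B ∨ l = (a, z) := by
          simp only [List.mem_append, List.mem_cons] at hl ⊢; tauto
        rcases hl with hl | rfl
        · exact hr l (hAB ▸ hl)
        · exact Finset.mem_range.1 hz
    rw [h1, hsum]
    simp only [ins_sum, ins_mul_left]
    rw [Finset.sum_comm]
    refine Finset.sum_congr rfl fun π _ => ?_
    rw [← Finset.mul_sum, sum_ins_sublist ((window_map_fst_perm π).nodup_iff.2 List.nodup_range')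
      (fun l hl => snd_lt_of_mem_window hl) ((window_map_fst_perm π).mem_iff.2 ha) haW]

end Iterate

open Polynomial

/-! ### Pair factors and the tail product -/

section Pairs

theorem qnum_mul (m : ℕ) (y : ℂ[X]) : qnum m y * (1 - y) = 1 - y ^ m :=
  geom_sum_mul_neg y m

/-- The factor contributed by the insertion of a pair of consecutive letters into a word of
length `m`. -/
noncomputable def pairFactor (r m : ℕ) (x : ℂ[X]) : ℂ[X] :=
  qnum ((m + 1) * r) ((-1) ^ m * x) * qnum ((m + 2) * r) ((-1) ^ (m + 1) * x)

/-- The signs disappear from the powers because `m * (m + 1)` is even, while the two denominators `1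
∓ x` and `1 ± x` multiply to `1 - x ^ 2`. -/
theorem pairFactor_mul (r m : ℕ) (x : ℂ[X]) :
    pairFactor r m x * (1 - x ^ 2) = (1 - (x ^ r) ^ (m + 1)) * (1 - (x ^ r) ^ (m + 2)) := by
  have h1 := qnum_mul ((m + 1) * r) ((-1) ^ m * x)
  have h2 := qnum_mul ((m + 2) * r) ((-1) ^ (m + 1) * x)
  have e1 : ((-1 : ℂ[X]) ^ m * x) ^ ((m + 1) * r) = (x ^ r) ^ (m + 1) := by
    rw [mul_pow, ← pow_mul, ← mul_assoc, ((Nat.even_mul_succ_self m).mul_right r).neg_one_pow,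
      one_mul, mul_comm, pow_mul]
  have e2 : ((-1 : ℂ[X]) ^ (m + 1) * x) ^ ((m + 2) * r) = (x ^ r) ^ (m + 2) := by
    rw [mul_pow, ← pow_mul, ← mul_assoc, ((Nat.even_mul_succ_self (m + 1)).mul_right r).neg_one_pow,
      one_mul, mul_comm, pow_mul]
  rw [e1] at h1
  rw [e2] at h2
  rw [← h1, ← h2, pairFactor]
  rcases neg_one_pow_eq_or ℂ[X] m with h | h <;> rw [pow_succ, h] <;> ring

theorem one_sub_sq_ne_zero {r : ℕ} {x : ℂ[X]} (hx : 1 - (x ^ r) ^ 2 ≠ 0) : 1 - x ^ 2 ≠ 0 := by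
  intro h
  refine hx ?_
  rw [← pow_mul, mul_comm, pow_mul, ← sub_eq_zero.1 h, one_pow, sub_self]

theorem sum_ins_ins_eq_pairFactor {r : ℕ} {x : ℂ[X]} (hx : 1 - (x ^ r) ^ 2 ≠ 0) (a : ℕ)
    (w : List ColInt) (ha : ∀ l ∈ w, l.1 ≠ a ∧ l.1 ≠ a + 1) :
    ∑ y ∈ Finset.range r, ∑ z ∈ Finset.range r,
      ins (a, y) w (fun u => ins (a + 1, z) u (weight (x ^ r) x)) =
    weight (x ^ r) x w * pairFactor r w.length x := by
  have h := sum_ins_ins_weight (x ^ r) x r a w ha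
  have h1 := pairFactor_mul r w.length x
  have h2 := geom_sum_mul_neg (x ^ 2) r
  rw [← pow_mul, mul_comm 2 r, pow_mul] at h2
  refine mul_left_cancel₀ (mul_ne_zero hx (one_sub_sq_ne_zero hx)) ?_
  linear_combination (1 - x ^ 2) * h - weight (x ^ r) x w * (1 - (x ^ r) ^ 2) * h1 +
    weight (x ^ r) x w * ((1 - (x ^ r) ^ (w.length + 1)) * (1 - (x ^ r) ^ (w.length + 2))) * h2

theorem append_cons_perm {as A B : List ℕ} {a : ℕ} :
    (as ++ (A ++ a :: B)).Perm (a :: (as ++ (A ++ B))) := by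
  simp only [← List.append_assoc]
  exact List.perm_middle

theorem nodup_of_insert {as : List ℕ} {A B w : List ColInt} {a z : ℕ} (hw : A ++ B = w)
    (h : (a :: as ++ w.map Prod.fst).Nodup) :
    (as ++ (A ++ (a, z) :: B).map Prod.fst).Nodup := by
  rw [← hw] at h
  rw [List.map_append, List.map_cons]
  rw [List.map_append] at h
  exact append_cons_perm.nodup_iff.2 h

theorem iterIns_pairs {r : ℕ} {x : ℂ[X]} (hx : 1 - (x ^ r) ^ 2 ≠ 0) (ps : List ℕ)
    (w : List ColInt) (h : (ps.flatMap (fun a => [a, a + 1]) ++ w.map Prod.fst).Nodup) :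
    iterIns r (ps.flatMap fun a => [a, a + 1]) w (weight (x ^ r) x) =
      weight (x ^ r) x w * ∏ i ∈ Finset.range ps.length, pairFactor r (w.length + 2 * i) x := by
  induction ps generalizing w with
  | nil => simp [iterIns]
  | cons a ps ih =>
    have hc : (a :: ps).flatMap (fun a => [a, a + 1]) =
      a :: (a + 1) :: ps.flatMap (fun a => [a, a + 1]) := rfl
    rw [hc] at h ⊢
    have ha : ∀ l ∈ w, l.1 ≠ a ∧ l.1 ≠ a + 1 := by
      intro l hl
      have hl : l.1 ∈ w.map Prod.fst := List.mem_map_of_mem hl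
      simp only [List.cons_append, List.nodup_cons, List.mem_cons, List.mem_append, not_or] at h
      exact ⟨fun e => h.1.2.2 (e ▸ hl), fun e => h.2.1.2 (e ▸ hl)⟩
    have h1 : iterIns r (a :: (a + 1) :: ps.flatMap (fun a => [a, a + 1])) w (weight (x ^ r) x) =
        (∏ i ∈ Finset.range ps.length, pairFactor r (w.length + 2 + 2 * i) x) *
          ∑ y ∈ Finset.range r, ∑ z ∈ Finset.range r,
            ins (a, y) w (fun u => ins (a + 1, z) u (weight (x ^ r) x)) := by
      rw [iterIns, Finset.mul_sum]
      refine Finset.sum_congr rfl fun y _ => ?_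
      simp only [iterIns]
      rw [ins_sum, Finset.mul_sum]
      refine Finset.sum_congr rfl fun z _ => ?_
      rw [← ins_mul_left]
      refine ins_congr fun A B hAB => ?_
      rw [← ins_mul_left]
      refine ins_congr fun C D hCD => ?_
      have hlen : (C ++ (a + 1, z) :: D).length = w.length + 2 := by
        have e1 := congrArg List.length hAB
        have e2 := congrArg List.length hCD
        simp only [List.length_append, List.length_cons] at e1 e2 ⊢
        omega
      rw [ih _ (nodup_of_insert hCD (nodup_of_insert hAB h)), hlen, mul_comm]
    rw [h1, sum_ins_ins_eq_pairFactor hx a w ha, List.length_cons, Finset.prod_range_succ']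
    rw [mul_zero, add_zero, mul_comm, mul_assoc, mul_comm (pairFactor _ _ _)]
    have h2 : ∏ i ∈ Finset.range ps.length, pairFactor r (w.length + 2 + 2 * i) x =
        ∏ i ∈ Finset.range ps.length, pairFactor r (w.length + 2 * (i + 1)) x :=
      Finset.prod_congr rfl fun i _ => by rw [mul_add, mul_one, add_assoc, add_comm 2]
    rw [h2]

/-- A pair factor sees only the length of the word, so pairs inserted last pull out of the sum over
the earlier insertions. -/
theorem iterIns_append_pairs {r : ℕ} {x : ℂ[X]} (hx : 1 - (x ^ r) ^ 2 ≠ 0) (as ps : List ℕ)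
    (w : List ColInt) (h : (as ++ ps.flatMap (fun a => [a, a + 1]) ++ w.map Prod.fst).Nodup) :
    iterIns r (as ++ ps.flatMap fun a => [a, a + 1]) w (weight (x ^ r) x) =
      iterIns r as w (weight (x ^ r) x) *
        ∏ i ∈ Finset.range ps.length, pairFactor r (w.length + as.length + 2 * i) x := by
  induction as generalizing w with
  | nil => exact iterIns_pairs hx ps w h
  | cons a as ih =>
    rw [List.cons_append, iterIns, iterIns, Finset.sum_mul]
    refine Finset.sum_congr rfl fun y _ => ?_
    rw [mul_comm, ← ins_mul_left]
    refine ins_congr fun A B hAB => ?_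
    rw [ih _ (nodup_of_insert hAB h), mul_comm]
    have hlen : (A ++ (a, y) :: B).length = w.length + 1 := by simp [← hAB]; ring
    rw [hlen, List.length_cons, add_assoc _ 1, add_comm 1]

theorem prod_pairFactor (r m s : ℕ) (x : ℂ[X]) :
    ∏ i ∈ Finset.range s, pairFactor r (m + 2 * i) x = tailProd r (m + 1) (m + 2 * s) x := by
  induction s with
  | zero => simp [tailProd]
  | succ s ih =>
    rw [Finset.prod_range_succ, ih, tailProd, tailProd, show m + 2 * (s + 1) = m + 2 * s + 1 + 1 by
      ring, Finset.prod_Icc_succ_top (by omega), Finset.prod_Icc_succ_top (by omega), mul_assoc]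
    rfl

theorem flatMap_range'_two (a s : ℕ) :
    (List.range' a s 2).flatMap (fun a => [a, a + 1]) = List.range' a (2 * s) := by
  induction s generalizing a with
  | zero => rfl
  | succ s ih => simp [List.range'_succ, mul_add, ih]

theorem signedMahonian_eq_sum {r n h : ℕ} [NeZero r] {ζ : ℂ} (hζ : ζ ^ r = 1) (S : Finset (G r n)) :
    signedMahonian ζ (-1) h S =
      ∑ π ∈ S, weight ((C (ζ ^ h) * X) ^ r) (C (ζ ^ h) * X) (window π) := by
  refine Finset.sum_congr rfl fun π _ => ?_
  have h1 : (C (ζ ^ h) * X : ℂ[X]) ^ r = X ^ r := by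
    rw [mul_pow, ← C_pow, ← pow_mul, mul_comm h, pow_mul, hζ, one_pow, C_1, one_mul]
  rw [h1, weight, chi, fmaj, inv_eq_invRec, majF_eq_posSum, C_mul, C_pow, C_neg, C_1, pow_mul,
    mul_pow, C_pow, ← C_pow, pow_add, pow_mul]
  ring

theorem run_succ (a k : ℕ) : run a (k + 1) = (a, 0) :: run (a + 1) k := by
  simp [run, List.range'_succ]

theorem run_map_fst (a k : ℕ) : (run a k).map Prod.fst = List.range' a k := by
  simp [run, Function.comp_def]

theorem length_run (a k : ℕ) : (run a k).length = k := by simp [run]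

theorem mem_run {a k : ℕ} {l : ColInt} (hl : l ∈ run a k) : a ≤ l.1 ∧ l.1 < a + k ∧ l.2 = 0 := by
  simp only [run, List.mem_map, List.mem_range'_1] at hl
  obtain ⟨m, hm, rfl⟩ := hl
  exact ⟨hm.1, hm.2, rfl⟩

theorem signedMahonian_containing {r n h : ℕ} [NeZero r] {ζ : ℂ} (hζ : ζ ^ r = 1) {x : ℂ[X]}
    (hx : x = C (ζ ^ h) * X) (hx1 : 1 - (x ^ r) ^ 2 ≠ 0) (as : List ℕ) (s t b a k : ℕ)
    (hp : (as ++ (List.range' 1 (2 * s) ++ List.range' b (2 * t)) ++ List.range' a k).Perm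
      (List.range' 1 n)) :
    signedMahonian ζ (-1) h (containing r n (run a k)) =
      iterIns r as (run a k) (weight (x ^ r) x) * tailProd r (k + as.length + 1) n x := by
  have hlen := hp.length_eq
  simp only [List.length_append, List.length_range'] at hlen
  rw [← flatMap_range'_two, ← flatMap_range'_two, ← List.flatMap_append, ← run_map_fst] at hp
  rw [signedMahonian_eq_sum hζ, ← hx, sum_containing _ _ _ hp, iterIns_append_pairs hx1 _ _ _
    (hp.nodup_iff.2 List.nodup_range'), prod_pairFactor, length_run]
  · simp only [List.length_append, List.length_range']
    congr 2
    omega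
  · intro l hl
    rw [(mem_run hl).2.2]
    exact NeZero.pos r

end Pairs

/-! ### Inserting one or two extremal letters into a run -/

section Core

variable {R : Type*} [CommRing R]

/-- The alternating sum of `Φ` over the descent words obtained by inserting a least letter into a
nonempty word with descent word `L`. -/
def leastIns (Φ : List Bool → R) (L : List Bool) : R := Φ (false :: L) - leastAfter L Φ

theorem invRec_insert_min {c z : ℕ} {A B : List ColInt} (h : ∀ l ∈ A ++ B, c < l.1) :
    invRec (A ++ (c, z) :: B) = invRec (A ++ B) + A.length := by
  rw [invRec_append_cons, List.countP_eq_length.2, List.countP_eq_zero.2, add_zero]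
  · intro l hl
    have := h l (by simp [hl])
    simp only [decide_eq_true_eq]; omega
  · intro l hl
    have := h l (by simp [hl])
    simp only [decide_eq_true_eq]; omega

theorem invRec_insert_max {b y : ℕ} {A B : List ColInt} (h : ∀ l ∈ A ++ B, l.1 < b) :
    invRec (A ++ (b, y) :: B) = invRec (A ++ B) + B.length := by
  rw [invRec_append_cons, List.countP_eq_zero.2, List.countP_eq_length.2, add_zero]
  · intro l hl
    have := h l (by simp [hl])
    simp only [decide_eq_true_eq]; omega
  · intro l hl
    have := h l (by simp [hl])
    simp only [decide_eq_true_eq]; omega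

theorem neg_one_pow_length_right {A B w : List ColInt} (hw : A ++ B = w) :
    (-1 : R) ^ B.length = (-1) ^ w.length * (-1) ^ A.length := by
  rw [← hw, List.length_append, ← pow_add, add_comm A.length, add_assoc, pow_add]
  simp

theorem ins_weight_of_min (X x : R) {c z : ℕ} {w : List ColInt} (h : ∀ l ∈ w, c < l.1) :
    ins (c, z) w (weight X x) = ((-1) ^ invRec w * x ^ (col w + z)) *
      alt (c, z) w (fun u => X ^ posSum 1 (desWord u)) := by
  refine ins_eq_mul_alt fun A B hw => ?_
  rw [weight, invRec_insert_min (by rwa [hw]), col_append_cons, hw, pow_add _ (invRec w)]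
  ring

theorem ins_weight_of_max (X x : R) {b y : ℕ} {w : List ColInt} (h : ∀ l ∈ w, l.1 < b) :
    ins (b, y) w (weight X x) = ((-1) ^ w.length * (-1) ^ invRec w * x ^ (col w + y)) *
      alt (b, y) w (fun u => X ^ posSum 1 (desWord u)) := by
  refine ins_eq_mul_alt fun A B hw => ?_
  rw [weight, invRec_insert_max (by rwa [hw]), col_append_cons, hw, pow_add _ (invRec w),
    neg_one_pow_length_right hw]
  ring

theorem alt_of_least (Φ : List Bool → R) {e : ColInt} {w : List ColInt} (hw : w ≠ [])
    (h : ∀ l ∈ w, ColLT e l ∧ ¬ColLT l e) :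
    alt e w (fun u => Φ (desWord u)) = leastIns Φ (desWord w) := by
  obtain ⟨y, t, rfl⟩ := List.exists_cons_of_ne_nil hw
  exact alt_cons_desWord_of_least Φ h

theorem desWord_run (a j : ℕ) : desWord (run a (j + 1)) = List.replicate j false := by
  induction j generalizing a with
  | zero => rfl
  | succ j ih =>
    have := ih (a + 1)
    rw [run_succ] at this
    rw [run_succ, run_succ, desWord, this, List.replicate_succ]
    simp [colLT_def]

theorem invRec_run (a k : ℕ) : invRec (run a k) = 0 := by
  induction k generalizing a with
  | zero => rfl
  | succ k ih =>
    rw [run_succ, invRec, ih, add_zero, List.countP_eq_zero]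
    intro l hl
    have := mem_run hl
    simp only [decide_eq_true_eq]; omega

theorem col_run (a k : ℕ) : col (run a k) = 0 := by
  simp [col, run, Function.comp_def]

theorem weight_run (X x : R) (a k : ℕ) : weight X x (run a k) = 1 := by
  rw [weight, invRec_run, col_run]
  cases k with
  | zero => simp [run, desWord, posSum]
  | succ k => simp [desWord_run, posSum_replicate]

theorem colLT_of_least_run {a k c z : ℕ} (h : c < a ∨ 0 < z) :
    ∀ l ∈ run a k, ColLT (c, z) l ∧ ¬ColLT l (c, z) := by
  intro l hl
  have := mem_run hl
  simp only [colLT_def]; omega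

theorem alt_run_of_greatest (Φ : List Bool → R) {a j b : ℕ} (hb : a + j < b) :
    alt (b, 0) (run a (j + 1)) (fun u => Φ (desWord u)) =
      leastAfter (List.replicate j false) Φ +
        (-1) ^ (j + 1) * Φ (List.replicate (j + 1) false) := by
  have h := alt_cons_desWord_of_greatest Φ (e := (b, 0)) (y := (a, 0)) (t := run (a + 1) j) (by
    rw [← run_succ]
    intro l hl
    have := mem_run hl
    simp only [colLT_def]; omega) (by rw [← run_succ, desWord_run, length_run])
  rwa [← run_succ, length_run] at h

theorem leastIns_replicate_pow_posSum (X : R) (j : ℕ) :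
    leastIns (fun L => X ^ posSum 1 L) (List.replicate j false) =
      ∑ i ∈ Finset.range (j + 2), (-X) ^ i := by
  rw [leastIns, ← List.replicate_succ, posSum_replicate, leastAfter_replicate_pow_posSum,
    Finset.sum_range_succ' _ (j + 1)]
  simp only [pow_succ (-X), ← Finset.sum_mul]
  ring

theorem ins_run_of_min (X x : R) {a j c z : ℕ} (hc : c < a) :
    ins (c, z) (run a (j + 1)) (weight X x) = x ^ z * ∑ i ∈ Finset.range (j + 2), (-X) ^ i := by
  rw [ins_weight_of_min X x fun l hl => by have := mem_run hl; omega,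
    alt_of_least (fun L => X ^ posSum 1 L) (by simp [run_succ]) (colLT_of_least_run (.inl hc)),
    invRec_run, col_run, desWord_run, leastIns_replicate_pow_posSum]
  simp

/-- With positive color the new letter is least in the color order. With color 0 it is greatest, and
the shift between greatest and least insertions turns the sum `S` for a least letter into `1 + (-1)
^ (j + 1) - S`. -/
theorem ins_run_of_max (X x : R) {a j b : ℕ} (y : ℕ) (hb : a + j < b) :
    ins (b, y) (run a (j + 1)) (weight X x) = (-1) ^ (j + 1) * x ^ y *
      if y = 0 then 1 + (-1) ^ (j + 1) - ∑ i ∈ Finset.range (j + 2), (-X) ^ i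
      else ∑ i ∈ Finset.range (j + 2), (-X) ^ i := by
  have hL := leastIns_replicate_pow_posSum X j
  rw [ins_weight_of_max X x fun l hl => by have := mem_run hl; omega, length_run, invRec_run,
    col_run]
  split_ifs with hy
  · subst hy
    rw [alt_run_of_greatest (fun L => X ^ posSum 1 L) hb, ← hL, leastIns, ← List.replicate_succ,
      posSum_replicate]
    ring
  · rw [alt_of_least (fun L => X ^ posSum 1 L) (by simp [run_succ])
      (colLT_of_least_run (.inr (by omega))), desWord_run, hL]
    simp

/-- Two successive insertions, the second one of a letter that is least both in the order of
colored integers and among the absolute values. -/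
theorem ins_ins_of_min (X x : R) {e : ColInt} {c z : ℕ} {w : List ColInt}
    {ε : R} (hw : ∀ l ∈ w, c < l.1 ∧ ColLT (c, z) l ∧ ¬ColLT l (c, z))
    (he : c < e.1 ∧ ColLT (c, z) e ∧ ¬ColLT e (c, z)) (hcol : col w = 0)
    (hε : ∀ A B, A ++ B = w → (-1) ^ invRec (A ++ e :: B) = ε * (-1) ^ A.length) :
    ins e w (fun u => ins (c, z) u (weight X x)) = ε * x ^ (e.2 + z) *
      alt e w (fun u => leastIns (fun L => X ^ posSum 1 L) (desWord u)) := by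
  refine ins_eq_mul_alt fun A B hAB => ?_
  have hl : ∀ l ∈ A ++ e :: B, c < l.1 ∧ ColLT (c, z) l ∧ ¬ColLT l (c, z) := by
    intro l hl
    have hl : l ∈ A ++ B ∨ l = e := by
      simp only [List.mem_append, List.mem_cons] at hl ⊢; tauto
    rcases hl with hl | rfl
    · exact hw l (hAB ▸ hl)
    · exact he
  rw [ins_weight_of_min X x fun l h => (hl l h).1,
    alt_of_least (fun L => X ^ posSum 1 L) (by simp) fun l h => (hl l h).2, hε A B hAB,
    col_append_cons, hAB, hcol]
  ring

theorem ins_ins_of_max (X x : R) {e : ColInt} {b y : ℕ} {w : List ColInt}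
    {ε : R} (hw : ∀ l ∈ w, l.1 < b ∧ ColLT (b, y) l ∧ ¬ColLT l (b, y))
    (he : e.1 < b ∧ ColLT (b, y) e ∧ ¬ColLT e (b, y)) (hcol : col w = 0)
    (hε : ∀ A B, A ++ B = w → (-1) ^ invRec (A ++ e :: B) = ε * (-1) ^ A.length) :
    ins e w (fun u => ins (b, y) u (weight X x)) = (-1) ^ (w.length + 1) * ε * x ^ (e.2 + y) *
      alt e w (fun u => leastIns (fun L => X ^ posSum 1 L) (desWord u)) := by
  refine ins_eq_mul_alt fun A B hAB => ?_
  have hl : ∀ l ∈ A ++ e :: B, l.1 < b ∧ ColLT (b, y) l ∧ ¬ColLT l (b, y) := by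
    intro l hl
    have hl : l ∈ A ++ B ∨ l = e := by
      simp only [List.mem_append, List.mem_cons] at hl ⊢; tauto
    rcases hl with hl | rfl
    · exact hw l (hAB ▸ hl)
    · exact he
  have hlen : (A ++ e :: B).length = w.length + 1 := by simp [← hAB]; ring
  rw [ins_weight_of_max X x fun l h => (hl l h).1,
    alt_of_least (fun L => X ^ posSum 1 L) (by simp) fun l h => (hl l h).2, hε A B hAB,
    col_append_cons, hAB, hcol, hlen]
  ring

/-- The alternating sum over the insertions of two least letters into an increasing word. -/
def twoLeast (X : R) (j : ℕ) : R :=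
  leastIns (leastIns fun L => X ^ posSum 1 L) (List.replicate j false)

theorem twoLeast_mul (X : R) (j : ℕ) :
    (1 - X ^ 2) * twoLeast X j = (1 - X ^ (j + 2)) * (1 - X ^ (j + 3)) := by
  -- With one color and `x = 1`, inserting 2 and then 1 into a run starting at 3 is a double
  -- insertion of least letters, so the pair formula evaluates it.
  have h := sum_ins_ins_weight X 1 1 1 (run 3 (j + 1)) fun l hl => by have := mem_run hl; omega
  simp only [Finset.sum_range_one] at h
  rw [ins_comm, ins_ins_of_min X 1 (ε := 1), alt_of_least _ (by simp [run_succ]), desWord_run,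
    weight_run, length_run] at h
  · rw [twoLeast]
    simpa using h
  · exact colLT_of_least_run (.inl (by omega))
  · intro l hl
    exact ⟨by have := mem_run hl; omega, colLT_of_least_run (.inl (by omega)) l hl⟩
  · simp [colLT_def]
  · exact col_run _ _
  · intro A B hAB
    rw [invRec_insert_min, hAB, invRec_run, zero_add, one_mul]
    intro l hl
    have := mem_run (hAB ▸ hl)
    omega

/-- Whichever of the two letters is smaller in the color order should be inserted last, as it is
then least. For `y ≤ z` this is `(c, z)`; for `z < y` the order is reversed, which costs a sign. For
`y = 0` the letter `(b, 0)` is greatest in the run. -/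
theorem ins_ins_run (X x : R) {a j b c : ℕ} (y z : ℕ) (hb : a + j < b) (hc : c < a) :
    ins (b, y) (run a (j + 1)) (fun u => ins (c, z) u (weight X x)) =
      (-1) ^ (j + 1) * (if y = 0 then
        ((1 + (-1) ^ (j + 1)) * (∑ i ∈ Finset.range (j + 3), (-X) ^ i) - twoLeast X j) * x ^ z else
        twoLeast X j * if y ≤ z then x ^ (y + z) else -x ^ (y + z)) := by
  have hmem : ∀ l ∈ run a (j + 1), c < l.1 ∧ l.1 < b := fun l hl => by
    have := mem_run hl
    omega
  have hmax : ∀ A B, A ++ B = run a (j + 1) →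
      (-1 : R) ^ invRec (A ++ (b, y) :: B) = (-1) ^ (j + 1) * (-1) ^ A.length := by
    intro A B hAB
    rw [invRec_insert_max fun l hl => (hmem l (hAB ▸ hl)).2, hAB, invRec_run, zero_add,
      neg_one_pow_length_right hAB, length_run]
  have hmin : ∀ A B, A ++ B = run a (j + 1) →
      (-1 : R) ^ invRec (A ++ (c, z) :: B) = 1 * (-1) ^ A.length := by
    intro A B hAB
    rw [invRec_insert_min fun l hl => (hmem l (hAB ▸ hl)).1, hAB, invRec_run, zero_add, one_mul]
  have hle : y ≤ z → ins (b, y) (run a (j + 1)) (fun u => ins (c, z) u (weight X x)) =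
      (-1) ^ (j + 1) * x ^ (y + z) * alt (b, y) (run a (j + 1))
        (fun u => leastIns (fun L => X ^ posSum 1 L) (desWord u)) := fun hyz =>
    ins_ins_of_min X x
      (fun l hl => ⟨(hmem l hl).1, colLT_of_least_run (.inl hc) l hl⟩)
      ⟨by simp only; omega, by simp only [colLT_def]; omega, by simp only [colLT_def]; omega⟩
      (col_run _ _) hmax
  split_ifs with hy hyz
  · subst hy
    have h2 : twoLeast X j =
        leastIns (fun L => X ^ posSum 1 L) (List.replicate (j + 1) false) -
          leastAfter (List.replicate j false) (leastIns fun L => X ^ posSum 1 L) := rfl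
    rw [hle (Nat.zero_le z), alt_run_of_greatest _ hb, h2, ← leastIns_replicate_pow_posSum]
    ring
  · rw [hle hyz, alt_of_least _ (by simp [run_succ]) (colLT_of_least_run (.inr (by omega))),
      desWord_run, twoLeast]
    ring
  · rw [ins_comm, ins_ins_of_max X x
      (fun l hl => ⟨(hmem l hl).2, colLT_of_least_run (.inr (by omega)) l hl⟩)
      ⟨by simp only; omega, by simp only [colLT_def]; omega, by simp only [colLT_def]; omega⟩
      (col_run _ _) hmin, alt_of_least _ (by simp [run_succ]) (colLT_of_least_run (.inl hc)),
      desWord_run, length_run, twoLeast]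
    ring

/-- For positive `y ≠ z` the terms at `(y, z)` and `(z, y)` cancel. The diagonal and the terms with
`z = 0` remain. -/
theorem sum_signed_pow (x : R) (r : ℕ) :
    ∑ y ∈ Finset.range r, ∑ z ∈ Finset.range r,
      (if y = 0 then 0 else if y ≤ z then x ^ (y + z) else -x ^ (y + z)) =
    ∑ z ∈ Finset.range r, (x ^ 2) ^ z - ∑ z ∈ Finset.range r, x ^ z := by
  induction r with
  | zero => simp
  | succ r ih =>
    rcases Nat.eq_zero_or_pos r with rfl | hr
    · simp
    have h1 : ∑ y ∈ Finset.range r,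
        (if y = 0 then 0 else if y ≤ r then x ^ (y + r) else -x ^ (y + r)) =
        (∑ y ∈ Finset.range r, x ^ y) * x ^ r - x ^ r := by
      obtain ⟨s, rfl⟩ : ∃ s, r = s + 1 := ⟨r - 1, by omega⟩
      rw [Finset.sum_range_succ', Finset.sum_range_succ' _ s, add_mul, Finset.sum_mul]
      simp only [if_true, add_zero, pow_zero, one_mul, add_sub_cancel_right]
      refine Finset.sum_congr rfl fun i hi => ?_
      have := Finset.mem_range.1 hi
      rw [if_neg (by omega), if_pos (by omega), pow_add]
    have h2 : ∑ z ∈ Finset.range r,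
        (if r = 0 then 0 else if r ≤ z then x ^ (r + z) else -x ^ (r + z)) =
        -((∑ y ∈ Finset.range r, x ^ y) * x ^ r) := by
      rw [Finset.sum_mul, ← Finset.sum_neg_distrib]
      refine Finset.sum_congr rfl fun i hi => ?_
      have := Finset.mem_range.1 hi
      rw [if_neg (by omega), if_neg (by omega), pow_add, mul_comm]
    simp only [Finset.sum_range_succ, Finset.sum_add_distrib, ih, h1, h2]
    rw [if_neg (by omega), if_pos le_rfl, ← pow_mul, two_mul]
    ring

end Core

/-! ### Core sums over all colors -/

section CorePolynomial

theorem iterIns_run_min (r : ℕ) (X x : ℂ[X]) {a j c : ℕ} (hc : c < a) :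
    iterIns r [c] (run a (j + 1)) (weight X x) = qnum (j + 2) (-X) * qnum r x := by
  simp only [iterIns, ins_run_of_min X x hc]
  rw [← Finset.sum_mul, mul_comm]
  rfl

theorem iterIns_run_max {r : ℕ} (hr : 0 < r) (X x : ℂ[X]) {a j b : ℕ} (hb : a + j < b) :
    iterIns r [b] (run a (j + 1)) (weight X x) = (-1) ^ (j + 1) *
      (1 + (-1) ^ (j + 1) - 2 * qnum (j + 2) (-X) + qnum (j + 2) (-X) * qnum r x) := by
  simp only [iterIns, ins_run_of_max X x _ hb]
  obtain ⟨s, rfl⟩ : ∃ s, r = s + 1 := ⟨r - 1, by omega⟩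
  simp only [qnum]
  rw [Finset.sum_range_succ', Finset.sum_range_succ' (fun i => x ^ i)]
  simp only [Nat.add_eq_zero_iff, one_ne_zero, and_false, if_false, if_true, ← Finset.sum_mul,
    ← Finset.mul_sum]
  ring

theorem iterIns_run_max_min {r : ℕ} (hr : 0 < r) (X x : ℂ[X]) {a j b c : ℕ} (hb : a + j < b)
    (hc : c < a) :
    iterIns r [b, c] (run a (j + 1)) (weight X x) =
      (-1) ^ (j + 1) * twoLeast X j * (qnum r (x ^ 2) - 2 * qnum r x) +
        (1 + (-1) ^ (j + 1)) * qnum (j + 3) (-X) * qnum r x := by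
  have hsq : ((-1 : ℂ[X]) ^ (j + 1)) ^ 2 = 1 := by rw [← pow_mul, mul_comm, pow_mul]; simp
  have h1 := sum_signed_pow x r
  simp only [iterIns, ins_sum, ins_ins_run X x _ _ hb hc, ← Finset.mul_sum]
  have h2 : ∀ y z : ℕ, (if y = 0 then
        ((1 + (-1) ^ (j + 1)) * (∑ i ∈ Finset.range (j + 3), (-X) ^ i) - twoLeast X j) * x ^ z else
        twoLeast X j * if y ≤ z then x ^ (y + z) else -x ^ (y + z)) =
      (if y = 0 then ((1 + (-1) ^ (j + 1)) * qnum (j + 3) (-X) - twoLeast X j) * x ^ z else 0) +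
      twoLeast X j * (if y = 0 then 0 else if y ≤ z then x ^ (y + z) else -x ^ (y + z)) := by
    intro y z
    by_cases hy : y = 0 <;> simp [hy, qnum]
  simp only [h2, Finset.sum_add_distrib, ← Finset.mul_sum, h1]
  rw [Finset.sum_eq_single_of_mem 0 (Finset.mem_range.2 hr)
    (fun y _ hy => by simp [hy])]
  simp only [if_true, ← Finset.mul_sum]
  change (-1) ^ (j + 1) * (((1 + (-1) ^ (j + 1)) * qnum (j + 3) (-X) - twoLeast X j) * qnum r x +
    twoLeast X j * (qnum r (x ^ 2) - qnum r x)) = _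
  linear_combination (qnum (j + 3) (-X) * qnum r x) * hsq

end CorePolynomial

/-! ### Words containing both runs -/

section Containing

variable {r n : ℕ} [NeZero r]

theorem cons_sublist_of_sublist_append {α : Type*} {x : α} {t A B : List α} (hx : x ∉ A)
    (h : (x :: t).Sublist (A ++ B)) : (x :: t).Sublist B := by
  induction A with
  | nil => exact h
  | cons y A ih =>
    rw [List.cons_append, List.sublist_cons_iff] at h
    rcases h with h | ⟨r, h, -⟩
    · exact ih (fun h => hx (by simp [h])) h
    · exact (hx (by simp [(List.cons.inj h).1])).elim

/-- Without repetitions, the shared letter `y` has a single place in `w`: `x` stands before it and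
all of `t` after it. -/
theorem cons_sublist_of_overlap {α : Type*} {x y : α} {s t w : List α} (hw : w.Nodup)
    (h1 : (x :: y :: s).Sublist w) (h2 : (y :: t).Sublist w) : (x :: y :: t).Sublist w := by
  obtain ⟨r₁, r₂, rfl, hx, hy⟩ := List.cons_sublist_iff.1 h1
  have hy2 : y ∈ r₂ := hy.subset (by simp)
  have hy1 : y ∉ r₁ := fun h => (List.disjoint_of_nodup_append hw) h hy2
  exact (List.singleton_sublist.2 hx).append (cons_sublist_of_sublist_append hy1 h2)

theorem containing_inter_containing (a j : ℕ) [DecidableEq (G r n)] :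
    containing r n (run a (j + 2)) ∩ containing r n (run (a + 1) (j + 2)) =
      containing r n (run a (j + 3)) := by
  ext π
  simp only [containing, Finset.mem_inter, Finset.mem_filter, Finset.mem_univ, true_and]
  have hnd : (window π).Nodup :=
    ((window_map_fst_perm π).nodup_iff.2 List.nodup_range').of_map
  constructor
  · rintro ⟨h1, h2⟩
    rw [run_succ, run_succ] at h1
    rw [run_succ] at h2
    rw [run_succ, run_succ]
    exact cons_sublist_of_overlap hnd h1 h2
  · intro h
    refine ⟨List.Sublist.trans ?_ h, List.Sublist.trans ?_ h⟩
    · exact (List.range'_sublist_right.2 (Nat.le_succ _)).map _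
    · rw [run_succ a]
      exact List.sublist_cons_self _ _

theorem signedMahonian_sdiff_add_sdiff (ζ : ℂ) (h a j : ℕ) [DecidableEq (G r n)] :
    signedMahonian ζ (-1) h (containing r n (run a (j + 2)) \
        containing r n (run (a + 1) (j + 2))) +
      signedMahonian ζ (-1) h (containing r n (run (a + 1) (j + 2)) \
        containing r n (run a (j + 2))) =
    signedMahonian ζ (-1) h (containing r n (run a (j + 2))) +
      signedMahonian ζ (-1) h (containing r n (run (a + 1) (j + 2))) -
      2 * signedMahonian ζ (-1) h (containing r n (run a (j + 3))) := by
  have h1 := Finset.sum_inter_add_sum_sdiff (containing r n (run a (j + 2)))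
    (containing r n (run (a + 1) (j + 2)))
    fun π => C (chi ζ (-1) h π) * X ^ fmaj r (window π)
  have h2 := Finset.sum_inter_add_sum_sdiff (containing r n (run (a + 1) (j + 2)))
    (containing r n (run a (j + 2))) fun π => C (chi ζ (-1) h π) * X ^ fmaj r (window π)
  rw [Finset.inter_comm, containing_inter_containing] at h2
  rw [containing_inter_containing] at h1
  simp only [signedMahonian]
  linear_combination h1 + h2

end Containing

/-! ### Closed forms of the factors -/

section Algebra

theorem one_sub_pow_sq_ne_zero {r : ℕ} (hr : r ≠ 0) : (1 : ℂ[X]) - (X ^ r) ^ 2 ≠ 0 := by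
  intro h
  have h := congrArg (eval 2) h
  simp only [eval_sub, eval_one, eval_pow, eval_X, eval_zero] at h
  have h : ((2 : ℂ) ^ r) ^ 2 = 1 := (sub_eq_zero.1 h).symm
  have h : (2 ^ r) ^ 2 = 1 := by exact_mod_cast h
  have := Nat.one_lt_two_pow hr
  nlinarith

theorem tailProd_eq_pairFactor_mul (r m s : ℕ) (x : ℂ[X]) :
    tailProd r (m + 1) (m + 2 * (s + 1)) x =
      pairFactor r m x * tailProd r (m + 3) (m + 2 * (s + 1)) x := by
  have h : ∏ i ∈ Finset.range s, pairFactor r (m + 2 * (i + 1)) x =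
      ∏ i ∈ Finset.range s, pairFactor r (m + 2 + 2 * i) x :=
    Finset.prod_congr rfl fun i _ => by rw [mul_add, mul_one, add_assoc, add_comm 2]
  rw [← prod_pairFactor, Finset.prod_range_succ', h, prod_pairFactor, mul_comm, mul_zero, add_zero,
    show m + 2 + 2 * s = m + 2 * (s + 1) by ring]

/-- Both sides come from inserting a pair into a word of length `j + 1`; this makes the case without
unpaired letters comparable with the case of two. -/
theorem pairFactor_eq_twoLeast {r : ℕ} {x : ℂ[X]} (hx : 1 - (x ^ r) ^ 2 ≠ 0) (j : ℕ) :
    pairFactor r (j + 1) x = twoLeast (x ^ r) j * qnum r (x ^ 2) := by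
  have h1 := pairFactor_mul r (j + 1) x
  have h2 := twoLeast_mul (x ^ r) j
  have h3 := qnum_mul r (x ^ 2)
  rw [← pow_mul, mul_comm 2 r, pow_mul] at h3
  refine mul_left_cancel₀ (mul_ne_zero hx (one_sub_sq_ne_zero hx)) ?_
  linear_combination (1 - (x ^ r) ^ 2) * h1 - (1 - x ^ 2) * qnum r (x ^ 2) * h2 -
    (1 - (x ^ r) ^ (j + 2)) * (1 - (x ^ r) ^ (j + 3)) * h3

theorem twoLeast_of_even {Y : ℂ[X]} (hY : 1 - Y ^ 2 ≠ 0) {j : ℕ} (hj : Even j) :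
    twoLeast Y j = qnum (j + 2) (-Y) * qnum (j + 3) Y := by
  have h1 := twoLeast_mul Y j
  have h2 := qnum_mul (j + 2) (-Y)
  have h3 := qnum_mul (j + 3) Y
  rw [(hj.add even_two).neg_pow] at h2
  refine mul_left_cancel₀ hY ?_
  linear_combination h1 - (1 - Y ^ (j + 3)) * h2 - qnum (j + 2) (-Y) * (1 + Y) * h3

theorem twoLeast_of_odd {Y : ℂ[X]} (hY : 1 - Y ^ 2 ≠ 0) {j : ℕ} (hj : Odd j) :
    twoLeast Y j = qnum (j + 2) Y * qnum (j + 3) (-Y) := by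
  have h1 := twoLeast_mul Y j
  have h2 := qnum_mul (j + 2) Y
  have h3 := qnum_mul (j + 3) (-Y)
  rw [(show Even (j + 3) from hj.add_odd (by decide)).neg_pow] at h3
  refine mul_left_cancel₀ hY ?_
  linear_combination h1 - (1 - Y ^ (j + 2)) * h3 - qnum (j + 3) (-Y) * (1 + Y) * h2

theorem fFactor_eq {r : ℕ} (hr : 0 < r) {x : ℂ[X]} (hx : 1 - x ^ 2 ≠ 0) :
    fFactor r x = qnum r (x ^ 2) - qnum r x := by
  obtain ⟨s, rfl⟩ : ∃ s, r = s + 1 := ⟨r - 1, by omega⟩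
  have h1 := qnum_mul (s + 1) (x ^ 2)
  have h2 := qnum_mul (s + 1) x
  have h3 := qnum_mul s ((-1) ^ (s + 1) * x)
  have h4 := qnum_mul (s + 1) ((-1) ^ s * x)
  rw [← pow_mul, mul_comm 2 (s + 1), pow_mul] at h1
  rw [fFactor, Nat.add_sub_cancel]
  refine mul_left_cancel₀ hx ?_
  rcases Nat.even_or_odd s with hs | hs
  · simp only [hs.neg_one_pow, hs.add_one.neg_one_pow, one_mul, neg_mul, hs.neg_pow] at h3 h4 ⊢
    linear_combination (-x * qnum (s + 1) x * (1 - x)) * h3 - x * (1 - x ^ s) * h4 - h1 +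
      (1 + x) * h2
  · simp only [hs.neg_one_pow, hs.add_one.neg_one_pow, one_mul, neg_mul, hs.add_one.neg_pow]
      at h3 h4 ⊢
    linear_combination (-x * qnum (s + 1) (-x) * (1 + x)) * h3 - x * (1 - x ^ s) * h4 - h1 +
      (1 + x) * h2

end Algebra

/-! ### Splitting off the paired letters -/

section Assembly

theorem signedMahonian_run {r n h : ℕ} [NeZero r] {ζ : ℂ} (hζ : ζ ^ r = 1) {x : ℂ[X]}
    (hx : x = C (ζ ^ h) * X) (hx1 : 1 - (x ^ r) ^ 2 ≠ 0) (as : List ℕ) (s t b a k : ℕ)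
    (hlen : as.length + (2 * s + 2 * t) + k = n)
    (hmem : ∀ m, 1 ≤ m → m ≤ n → m ∈ as ∨ m < 1 + 2 * s ∨ (b ≤ m ∧ m < b + 2 * t) ∨
      (a ≤ m ∧ m < a + k)) :
    signedMahonian ζ (-1) h (containing r n (run a k)) =
      iterIns r as (run a k) (weight (x ^ r) x) * tailProd r (k + as.length + 1) n x := by
  refine signedMahonian_containing hζ hx hx1 as s t b a k (List.Perm.symm ?_)
  refine (List.subperm_of_subset List.nodup_range' fun m hm => ?_).perm_of_length_le (by simp; omega)
  rw [List.mem_range'_1] at hm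
  simp only [List.mem_append, List.mem_range'_1]
  rcases hmem m hm.1 (by omega) with h | h | h | h
  · exact .inl (.inl h)
  · exact .inl (.inr (.inl ⟨hm.1, h⟩))
  · exact .inl (.inr (.inr h))
  · exact .inr h

end Assembly

end ColoredPerm

theorem theorem2p3 (r n k b h : ℕ) [NeZero r] (ζ : ℂ) (hζ : IsPrimitiveRoot ζ r) (hh : h < r)
    (hk : 1 ≤ k) (hkn : k ≤ n - 1) (hkb : k + 1 ≤ b) (hbn : b ≤ n) (hpar : b ≡ n [MOD 2])
    (U V : List ColoredPerm.ColInt)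
    (hU : U = ColoredPerm.run (b - k) k) (hV : V = ColoredPerm.run (b - k + 1) k)
    (q x : Polynomial ℂ) (hq : q = Polynomial.X) (hx : x = Polynomial.C (ζ ^ h) * q) :
    (Odd k →
      (Even n →
        ColoredPerm.signedMahonian ζ (-1) h (ColoredPerm.containing r n U) +
            ColoredPerm.signedMahonian ζ (-1) h (ColoredPerm.containing r n V) =
          2 * ColoredPerm.qnum (k + 1) (-(q ^ r)) * ColoredPerm.tailProd r (k + 2) n x) ∧
      (Odd n →
        ColoredPerm.signedMahonian ζ (-1) h (ColoredPerm.containing r n U) +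
            ColoredPerm.signedMahonian ζ (-1) h (ColoredPerm.containing r n V) =
          2 * (ColoredPerm.qnum (k + 1) (-(q ^ r)) * ColoredPerm.qnum (k + 2) (q ^ r) *
            ColoredPerm.qnum r x) * ColoredPerm.tailProd r (k + 3) n x)) ∧
    (Even k →
      (Odd n →
        ColoredPerm.signedMahonian ζ (-1) h
              (ColoredPerm.containing r n U \ ColoredPerm.containing r n V) +
            ColoredPerm.signedMahonian ζ (-1) h
              (ColoredPerm.containing r n V \ ColoredPerm.containing r n U) =
          2 * ColoredPerm.qnum (k + 1) (-(q ^ r)) * (ColoredPerm.qnum r x - 1) *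
            ColoredPerm.tailProd r (k + 2) n x) ∧
      (Even n →
        ColoredPerm.signedMahonian ζ (-1) h
              (ColoredPerm.containing r n U \ ColoredPerm.containing r n V) +
            ColoredPerm.signedMahonian ζ (-1) h
              (ColoredPerm.containing r n V \ ColoredPerm.containing r n U) =
          2 * ColoredPerm.fFactor r x *
            (ColoredPerm.qnum (k + 1) (q ^ r) * ColoredPerm.qnum (k + 2) (-(q ^ r))) *
            ColoredPerm.tailProd r (k + 3) n x)) := by
  obtain ⟨j, rfl⟩ : ∃ j, k = j + 1 := ⟨k - 1, by omega⟩
  obtain ⟨a, rfl⟩ : ∃ a, b = a + 1 + (j + 1) := ⟨b - (j + 1) - 1, by omega⟩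
  -- The parity hypothesis says that the letters above `b` form `t` pairs.
  obtain ⟨t, ht⟩ : ∃ t, n = a + 1 + (j + 1) + 2 * t := by
    refine ⟨(n - (a + 1 + (j + 1))) / 2, ?_⟩
    have : (a + 1 + (j + 1)) % 2 = n % 2 := hpar
    omega
  have hr : 0 < r := NeZero.pos r
  rw [Nat.add_sub_cancel] at hU hV
  subst hU hV hq
  have hxr : x ^ r = Polynomial.X ^ r := by
    rw [hx, mul_pow, ← Polynomial.C_pow, ← pow_mul, mul_comm h, pow_mul, hζ.pow_eq_one, one_pow,
      Polynomial.C_1, one_mul]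
  have hx1 : 1 - (x ^ r) ^ 2 ≠ 0 := hxr ▸ ColoredPerm.one_sub_pow_sq_ne_zero hr.ne'
  rw [← hxr]
  have hS := ColoredPerm.signedMahonian_run (n := n) hζ.pow_eq_one hx hx1
  have hεodd : Odd (j + 1) → (-1 : Polynomial ℂ) ^ (j + 1) = -1 := Odd.neg_one_pow
  have hεeven : Even (j + 1) → (-1 : Polynomial ℂ) ^ (j + 1) = 1 := Even.neg_one_pow
  -- The explicit lists in these six instances are the unpaired letters; `s` (or `s + 1`) counts the
  -- pairs below the run.
  have evenU : ∀ s, a = 2 * s → ColoredPerm.signedMahonian ζ (-1) h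
      (ColoredPerm.containing r n (ColoredPerm.run (a + 1) (j + 1))) = _ := fun s hs =>
    hS [a + 1 + (j + 1)] s t (a + 1 + (j + 1) + 1) (a + 1) (j + 1)
      (by simp only [List.length_singleton]; omega)
      (by simp only [List.mem_singleton]; omega)
  have evenV : ∀ s, a = 2 * s → ColoredPerm.signedMahonian ζ (-1) h
      (ColoredPerm.containing r n (ColoredPerm.run (a + 1 + 1) (j + 1))) = _ := fun s hs =>
    hS [a + 1] s t (a + 1 + (j + 1) + 1) (a + 1 + 1) (j + 1)
      (by simp only [List.length_singleton]; omega)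
      (by simp only [List.mem_singleton]; omega)
  have evenUV : ∀ s, a = 2 * s → ColoredPerm.signedMahonian ζ (-1) h
      (ColoredPerm.containing r n (ColoredPerm.run (a + 1) (j + 2))) = _ := fun s hs =>
    hS [] s t (a + 1 + (j + 1) + 1) (a + 1) (j + 2)
      (by simp only [List.length_nil]; omega)
      (by simp only [List.not_mem_nil]; omega)
  have oddU : ∀ s, a = 2 * s + 1 → ColoredPerm.signedMahonian ζ (-1) h
      (ColoredPerm.containing r n (ColoredPerm.run (a + 1) (j + 1))) = _ := fun s hs =>
    hS [a + 1 + (j + 1), a] s t (a + 1 + (j + 1) + 1) (a + 1) (j + 1)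
      (by simp only [List.length_cons, List.length_nil]; omega)
      (by simp only [List.mem_cons, List.not_mem_nil]; omega)
  have oddV : ∀ s, a = 2 * s + 1 → ColoredPerm.signedMahonian ζ (-1) h
      (ColoredPerm.containing r n (ColoredPerm.run (a + 1 + 1) (j + 1))) = _ := fun s hs =>
    hS [] (s + 1) t (a + 1 + (j + 1) + 1) (a + 1 + 1) (j + 1)
      (by simp only [List.length_nil]; omega)
      (by simp only [List.not_mem_nil]; omega)
  have oddUV : ∀ s, a = 2 * s + 1 → ColoredPerm.signedMahonian ζ (-1) h
      (ColoredPerm.containing r n (ColoredPerm.run (a + 1) (j + 2))) = _ := fun s hs =>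
    hS [a] s t (a + 1 + (j + 1) + 1) (a + 1) (j + 2)
      (by simp only [List.length_singleton]; omega)
      (by simp only [List.mem_singleton]; omega)
  -- For `V` with `a` odd nothing is unpaired, so its product starts two factors earlier than that
  -- of `U`; the extra pair is split off.
  have htail : ∀ s, a = 2 * s + 1 → ColoredPerm.tailProd r (j + 1 + 1) n x =
      ColoredPerm.twoLeast (x ^ r) j * ColoredPerm.qnum r (x ^ 2) *
        ColoredPerm.tailProd r (j + 1 + 3) n x := by
    intro s hs
    rw [← ColoredPerm.pairFactor_eq_twoLeast hx1,
      show n = j + 1 + 2 * (s + t + 1) by omega, ← ColoredPerm.tailProd_eq_pairFactor_mul]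
  rw [ColoredPerm.iterIns_run_max hr _ _ (by omega), List.length_singleton] at evenU
  rw [ColoredPerm.iterIns_run_min _ _ _ (by omega), List.length_singleton] at evenV
  rw [ColoredPerm.iterIns, ColoredPerm.weight_run, List.length_nil] at evenUV
  rw [ColoredPerm.iterIns_run_max_min hr _ _ (by omega) (by omega)] at oddU
  rw [ColoredPerm.iterIns, ColoredPerm.weight_run, List.length_nil] at oddV
  rw [ColoredPerm.iterIns_run_min _ _ _ (by omega), List.length_singleton] at oddUV
  refine ⟨fun hko => ⟨fun hne => ?_, fun hno => ?_⟩, fun hke => ⟨fun hno => ?_, fun hne => ?_⟩⟩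
  · obtain ⟨s, hs⟩ : ∃ s, a = 2 * s := ⟨a / 2, by rw [Nat.odd_iff, Nat.even_iff] at *; omega⟩
    -- For `k` odd the terms with `qnum r x` from `U` and `V` cancel, leaving twice the `q`-number.
    rw [evenU s hs, evenV s hs, hεodd hko]
    ring
  · obtain ⟨s, hs⟩ : ∃ s, a = 2 * s + 1 := ⟨a / 2, by rw [Nat.odd_iff] at *; omega⟩
    have hj : Even j := by rw [Nat.even_iff]; rw [Nat.odd_iff] at hko; omega
    rw [oddU s hs, oddV s hs, hεodd hko, add_zero, htail s hs,
      ColoredPerm.twoLeast_of_even hx1 hj]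
    simp only [List.length_cons, List.length_nil]
    ring
  · obtain ⟨s, hs⟩ : ∃ s, a = 2 * s := ⟨a / 2, by rw [Nat.odd_iff, Nat.even_iff] at *; omega⟩
    -- An even `k` is at least 2, so the two runs share a letter, as the intersection formula
    -- requires.
    obtain ⟨i, rfl⟩ : ∃ i, j = i + 1 := ⟨j - 1, by rw [Nat.even_iff] at hke; omega⟩
    rw [ColoredPerm.signedMahonian_sdiff_add_sdiff, evenU s hs, evenV s hs, evenUV s hs,
      hεeven hke]
    ring
  · obtain ⟨s, hs⟩ : ∃ s, a = 2 * s + 1 := ⟨a / 2, by rw [Nat.even_iff] at *; omega⟩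
    obtain ⟨i, rfl⟩ : ∃ i, j = i + 1 := ⟨j - 1, by rw [Nat.even_iff] at hke; omega⟩
    have hj : Odd (i + 1) := by rw [Nat.odd_iff]; rw [Nat.even_iff] at hke; omega
    -- The term with factor `1 + (-1) ^ k = 2` in the sum for `U` is cancelled by twice the sum for
    -- the union run; what remains is `2 * twoLeast` times `qnum r (x ^ 2) - qnum r x`, which is
    -- `fFactor`.
    rw [ColoredPerm.signedMahonian_sdiff_add_sdiff, oddU s hs, oddV s hs, oddUV s hs,
      hεeven hke, add_zero, htail s hs, ColoredPerm.twoLeast_of_odd hx1 hj,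
      ColoredPerm.fFactor_eq hr (ColoredPerm.one_sub_sq_ne_zero hx1)]
    simp only [List.length_cons, List.length_nil]
    ring
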